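/- **Conventions.** Let $\overline{\mathfrak a}$ be a finite-dimensional real vector space with a positive definite scalar product $\langle\cdot,\cdot\rangle$ and let $\mathfrak a$ be an affine space for $\overline{\mathfrak a}$. An affine linear function $\alpha:\mathfrak a\to\mathbb R$ has a gradient $\overline\alpha\in\overline{\mathfrak a}$, given by $\alpha(x+t)=\alpha(x)+\langle\overline\alpha,t\rangle$. If $\alpha$ is non-constant, put $\overline\alpha^\vee=\frac{2}{\|\overline\alpha\|^2}\overline\alpha$ and $H_\alpha=\{\alpha=0\}$, and let $s_\alpha(x)=x-\alpha(x)\overline\alpha^\vee$ be the reflection about $H_\alpha$; it acts on affine linear functions by $s_\alpha(\beta)=\beta-\langle\overline\beta,\overline\alpha^\vee\rangle\alpha$. A set $\Phi$ of non-constant affine linear functions on $\mathfrak a$ (possibly empty) is an *affine root system* if $\mathbb R\alpha\cap\Phi=\{\alpha,-\alpha\}$, $\langle\overline\alpha,\overline\beta^\vee\rangle\in\mathbb Z$ and $s_\alpha(\Phi)=\Phi$ for all $\alpha,\beta\in\Phi$, and $\overline\Phi=\{\overline\alpha\mid\alpha\in\Phi\}$ is finite. Its *Weyl group* is the group of isometries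 generated by all $s_\alpha$, $\alpha\in\Phi$. An *alcove* of $\Phi$ is the closure of a connected component of $\mathfrak a\setminus\bigcup_{\alpha\in\Phi}H_\alpha$. For $x\in\mathfrak a$ put $\Phi_x=\{\alpha\in\Phi\mid\alpha(x)=0\}$. Let $\Lambda\subseteq\overline{\mathfrak a}$ be a lattice (a discrete subgroup spanning $\overline{\mathfrak a}$). The pair $(\Phi,\Lambda)$ is an *integral affine root system* if $\Phi$ is an affine root system with $\overline\alpha\in\Lambda$ and $\langle\Lambda,\overline\alpha^\vee\rangle\subseteq\mathbb Z$ for all $\alpha\in\Phi$. A *local root system* on a subset $\mathcal P\subseteq\mathfrak a$ is a family $\Phi(*)=(\Phi(x))_{x\in\mathcal P}$ together with a lattice $\Lambda\subseteq\overline{\mathfrak a}$ such that: (1) $(\Phi(x),\Lambda)$ is an integral affine root system on $\mathfrak a$ for every $x\in\mathcal P$; (2) every $x\in\mathcal P$ has a neighborhood $U$ in $\mathcal P$ with $\Phi(y)=\Phi(x)_y$ for all $y\in U$; (3) for every $x\in\mathcal P$ and $\alpha\in\Phi(x)$, either $\alpha|_{\mathcal P}\ge0$ or $\alpha|_{\mathcal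 P}\le0$. The set $\mathcal P$ is *solid* if it is non-empty and its interior in $\mathfrak a$ is dense in it. **Proposition.** Let $(\Phi(*),\Lambda)$ be a local root system on $\mathcal P\subseteq\mathfrak a$, and let $W$ be the group of isometries of $\mathfrak a$ generated by the Weyl groups of all $\Phi(x)$, $x\in\mathcal P$. Assume that $\mathcal P$ is convex and solid and that every $W$-orbit in $\mathfrak a$ meets $\mathcal P$ in at most one point. Then the local root system is trivial: there is an integral affine root system $(\Phi,\Lambda)$ on $\mathfrak a$, with the same lattice $\Lambda$, such that $\mathcal P$ is contained in an alcove of $\Phi$ and $\Phi(x)=\Phi_x$ for all $x\in\mathcal P$. -/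

import Mathlib

open scoped Topology

namespace LocalRoot

variable {V E : Type*} [NormedAddCommGroup V] [InnerProductSpace ℝ V] [FiniteDimensional ℝ V]
  [MetricSpace E] [NormedAddTorsor V E]

/-- The gradient of an affine linear function on a Euclidean affine space, i.e. the Riesz
representative of its linear part. -/
noncomputable def grad (α : E →ᵃ[ℝ] ℝ) : V :=
  (InnerProductSpace.toDual ℝ V).symm (LinearMap.toContinuousLinearMap α.linear)

theorem inner_grad (α : E →ᵃ[ℝ] ℝ) (t : V) : inner ℝ (grad α) t = α.linear t := by
  simp [grad]

/-- The characterizing property of the gradient. -/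
theorem apply_vadd (α : E →ᵃ[ℝ] ℝ) (x : E) (t : V) :
    α (t +ᵥ x) = α x + inner ℝ (grad α) t := by
  rw [inner_grad, AffineMap.map_vadd, vadd_eq_add, add_comm]

/-- The vector `2 / ‖ᾱ‖² • ᾱ`, where `ᾱ` is the gradient of `α`. -/
noncomputable def coroot (α : E →ᵃ[ℝ] ℝ) : V := (2 / ‖grad α‖ ^ 2) • grad α

/-- The affine hyperplane on which a (non-constant) affine linear function vanishes. -/
def hyperplane (α : E →ᵃ[ℝ] ℝ) : Set E := {x | α x = 0}

theorem linear_reflection_apply (α : E →ᵃ[ℝ] ℝ) (t : V) :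
    (Submodule.span ℝ {grad α})ᗮ.reflection t = t - (α.linear t) • coroot α := by
  rw [Submodule.reflection_orthogonal_apply, Submodule.reflection_singleton_apply, inner_grad,
    coroot, smul_smul]
  simp only [RCLike.ofReal_real_eq_id, id_eq]
  rw [neg_sub, ← Nat.cast_smul_eq_nsmul ℝ, smul_smul]
  congr 2
  push_cast
  ring

/-- The reflection `x ↦ x - α(x) α^∨` about the hyperplane `α = 0`, as an isometry of the affine
space (it is the identity if `α` is constant). -/
noncomputable def refl (α : E →ᵃ[ℝ] ℝ) : E ≃ᵃⁱ[ℝ] E :=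
  AffineIsometryEquiv.mk' (fun x => -(α x • coroot α) +ᵥ x)
    (Submodule.span ℝ {grad α})ᗮ.reflection (Classical.arbitrary E) (by
      intro x
      rw [linear_reflection_apply, AffineMap.linearMap_vsub, vsub_eq_sub, vadd_vadd]
      conv_lhs => rw [← vsub_vadd x (Classical.arbitrary E), vadd_vadd]
      rw [vsub_vadd]
      congr 1
      module)

theorem refl_apply (α : E →ᵃ[ℝ] ℝ) (x : E) : refl α x = -(α x • coroot α) +ᵥ x := rfl

/-- The action of the reflection `s_α` on affine linear functions. -/
noncomputable def reflFun (α β : E →ᵃ[ℝ] ℝ) : E →ᵃ[ℝ] ℝ :=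
  β - (inner ℝ (grad β) (coroot α) : ℝ) • α

/-- The action on functions is the one induced by the action on points. -/
theorem reflFun_apply (α β : E →ᵃ[ℝ] ℝ) (x : E) : reflFun α β x = β (refl α x) := by
  rw [refl_apply, apply_vadd, inner_neg_right, inner_smul_right]
  simp only [reflFun, AffineMap.coe_sub, AffineMap.coe_smul, Pi.sub_apply, Pi.smul_apply,
    smul_eq_mul]
  ring

/-- Affine root systems: reduced, possibly finite, possibly empty, not necessarily irreducible. -/
structure IsAffineRootSystem (Φ : Set (E →ᵃ[ℝ] ℝ)) : Prop where
  nonconst : ∀ α ∈ Φ, ∀ c : ℝ, α ≠ AffineMap.const ℝ E c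
  reduced : ∀ α ∈ Φ, {β | ∃ c : ℝ, β = c • α} ∩ Φ = {α, -α}
  integral : ∀ α ∈ Φ, ∀ β ∈ Φ, ∃ n : ℤ, inner ℝ (grad α) (coroot β) = (n : ℝ)
  stable : ∀ α ∈ Φ, reflFun α '' Φ = Φ
  finite_grad : (grad '' Φ).Finite

/-- The Weyl group: the group of isometries generated by the reflections in the roots. -/
noncomputable def weylGroup (Φ : Set (E →ᵃ[ℝ] ℝ)) : Subgroup (E ≃ᵃⁱ[ℝ] E) :=
  Subgroup.closure (refl '' Φ)

/-- The roots vanishing at `x`. -/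
noncomputable def rootsAt (Φ : Set (E →ᵃ[ℝ] ℝ)) (x : E) : Set (E →ᵃ[ℝ] ℝ) := {α ∈ Φ | α x = 0}

/-- A chamber is a connected component of the complement of the root hyperplanes; an alcove is the
closure of a chamber. -/
def IsAlcove (Φ : Set (E →ᵃ[ℝ] ℝ)) (A : Set E) : Prop :=
  ∃ x ∈ (⋃ α ∈ Φ, hyperplane α)ᶜ,
    A = closure (connectedComponentIn (⋃ α ∈ Φ, hyperplane α)ᶜ x)

/-- A lattice: a discrete subgroup spanning the vector space. -/
structure IsLattice (L : AddSubgroup V) : Prop where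
  discrete : DiscreteTopology L
  span_eq_top : Submodule.span ℝ (L : Set V) = ⊤

/-- The dual lattice. -/
def dualLattice (L : AddSubgroup V) : Set V := {χ | ∀ v ∈ L, ∃ n : ℤ, inner ℝ v χ = (n : ℝ)}

/-- `(Φ, L)` is an integral affine root system: `L` is a weight lattice for the affine root
system `Φ`. -/
structure IsIntegralAffineRootSystem (Φ : Set (E →ᵃ[ℝ] ℝ)) (L : AddSubgroup V) : Prop where
  rootSystem : IsAffineRootSystem Φ
  lattice : IsLattice L
  grad_mem : ∀ α ∈ Φ, grad α ∈ L
  coroot_mem : ∀ α ∈ Φ, coroot α ∈ dualLattice L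

/-- Local root systems on a subset `P`. The filter `𝓝 x` is that of the subspace topology
of `P`. -/
structure IsLocalRootSystem (P : Set E) (Φ : P → Set (E →ᵃ[ℝ] ℝ)) (L : AddSubgroup V) :
    Prop where
  lattice : IsLattice L
  integral : ∀ x : P, IsIntegralAffineRootSystem (Φ x) L
  locally_eq : ∀ x : P, ∀ᶠ y : P in 𝓝 x, Φ y = rootsAt (Φ x) y
  sign : ∀ x : P, ∀ α ∈ Φ x, (∀ z ∈ P, 0 ≤ α z) ∨ (∀ z ∈ P, α z ≤ 0)

/-- A local root system is trivial if it comes from one integral affine root system having an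
alcove that contains `P`. -/
def IsTrivial (P : Set E) (Φ : P → Set (E →ᵃ[ℝ] ℝ)) (L : AddSubgroup V) : Prop :=
  ∃ Ψ : Set (E →ᵃ[ℝ] ℝ), IsIntegralAffineRootSystem Ψ L ∧
    (∃ A : Set E, IsAlcove Ψ A ∧ P ⊆ A) ∧ ∀ x : P, Φ x = rootsAt Ψ x

/-- The group generated by all local Weyl groups. -/
noncomputable def generatedGroup (P : Set E) (Φ : P → Set (E →ᵃ[ℝ] ℝ)) : Subgroup (E ≃ᵃⁱ[ℝ] E) :=
  ⨆ x : P, weylGroup (Φ x)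

/-- The orbit of a point under a group of isometries. -/
def orbit (W : Subgroup (E ≃ᵃⁱ[ℝ] E)) (z : E) : Set E := {y | ∃ w ∈ W, w z = y}

/-- Convexity of a subset of an affine space. -/
def IsConvex (P : Set E) : Prop := ∀ x ∈ P, ∀ y ∈ P, affineSegment ℝ x y ⊆ P

/-- A non-empty set is solid if its interior is dense in it. -/
def IsSolid (P : Set E) : Prop := P.Nonempty ∧ P ⊆ closure (interior P)

end LocalRoot

set_option linter.unusedSectionVars false

namespace LocalRoot

variable {V E : Type*} [NormedAddCommGroup V] [InnerProductSpace ℝ V] [FiniteDimensional ℝ V]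
  [MetricSpace E] [NormedAddTorsor V E]

/-! ### Gradients and reflections -/

/-! The global system is rebuilt from its simple roots. Call a local root positive if it is
non-negative on `P`, and simple if it is not a sum of two positive roots.

The orbit hypothesis enters once, in `IsLocalRootSystem.reflEquiv_ne_zero`: for local roots `a`, `b`
the reflection in `s_a b` is `s_a s_b s_a`, hence lies in the group `W`. If `s_a b` vanished at an
interior point of `P`, this reflection would exchange two nearby points of `P`. So `s_a b` has
constant sign on the convex solid set `P`. This excludes the Cartan number 1 between simple roots
(`inner_coroot_ne_one`), and they pairwise form non-acute angles (`isObtuseSystem`).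

Non-acute angles, integral Cartan numbers and a common point `p` of positivity suffice for the
classical positivity theorem of Coxeter groups (`IsObtuseSystem.map_mem_or_neg_mem`): each function
generated from the simple roots by reflections is, up to sign, a sum of simple roots. Linear
independence is never required; values at `p` take the place of coordinates and heights. Hence the
generated functions form a reduced system none of whose hyperplanes meets the interior of `P`; the
lattice supplies integrality and finiteness of the gradients.

Finally, `mem_of_reflEquiv_stable` compares `Φ x` with the generated roots through `x`: simple
reflections lower the value at `p` until a multiple of a simple root remains. -/

theorem grad_add (f g : E →ᵃ[ℝ] ℝ) : grad (f + g) = grad f + grad g := by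
  refine ext_inner_right ℝ fun t => ?_
  rw [inner_add_left, inner_grad, inner_grad, inner_grad]
  rfl

theorem grad_smul (c : ℝ) (f : E →ᵃ[ℝ] ℝ) : grad (c • f) = c • grad f := by
  refine ext_inner_right ℝ fun t => ?_
  rw [inner_smul_left, inner_grad, inner_grad]
  rfl

theorem grad_zero : grad (0 : E →ᵃ[ℝ] ℝ) = 0 := by
  have h := grad_smul 0 (0 : E →ᵃ[ℝ] ℝ)
  simpa using h

theorem grad_neg (f : E →ᵃ[ℝ] ℝ) : grad (-f) = -grad f := by
  have h := grad_smul (-1) f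
  simpa using h

theorem grad_sub (f g : E →ᵃ[ℝ] ℝ) : grad (f - g) = grad f - grad g := by
  rw [sub_eq_add_neg, grad_add, grad_neg, sub_eq_add_neg]

theorem inner_coroot (v : V) (a : E →ᵃ[ℝ] ℝ) :
    inner ℝ v (coroot a) = 2 / ‖grad a‖ ^ 2 * inner ℝ v (grad a) := by
  rw [coroot, inner_smul_right]

theorem inner_grad_coroot_self {a : E →ᵃ[ℝ] ℝ} (ha : grad a ≠ 0) :
    inner ℝ (grad a) (coroot a) = (2 : ℝ) := by
  have : ‖grad a‖ ≠ 0 := norm_ne_zero_iff.mpr ha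
  rw [inner_coroot, real_inner_self_eq_norm_sq]
  field_simp

theorem coroot_eq_zero {a : E →ᵃ[ℝ] ℝ} (ha : grad a = 0) : coroot a = 0 := by
  rw [coroot, ha, smul_zero]

theorem eq_of_grad_eq {f g : E →ᵃ[ℝ] ℝ} (h : grad f = grad g) {x : E} (hx : f x = g x) :
    f = g := by
  ext z
  rw [← vsub_vadd z x, apply_vadd, apply_vadd, h, hx]

theorem reflFun_reflFun (a f : E →ᵃ[ℝ] ℝ) : reflFun a (reflFun a f) = f := by
  by_cases ha : grad a = 0
  · simp [reflFun, coroot_eq_zero ha]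
  · unfold reflFun
    rw [grad_sub, grad_smul, inner_sub_left, inner_smul_left, inner_grad_coroot_self ha]
    simp only [conj_trivial]
    module

/-- The reflection in a function, acting linearly on affine linear functions. -/
noncomputable def reflEquiv (a : E →ᵃ[ℝ] ℝ) : (E →ᵃ[ℝ] ℝ) ≃ₗ[ℝ] (E →ᵃ[ℝ] ℝ) :=
  LinearEquiv.ofInvolutive
    { toFun := reflFun a
      map_add' := fun f g => by
        simp only [reflFun, grad_add, inner_add_left]
        module
      map_smul' := fun c f => by
        simp only [reflFun, grad_smul, inner_smul_left, conj_trivial, RingHom.id_apply]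
        module }
    (reflFun_reflFun a)

theorem reflEquiv_apply (a f : E →ᵃ[ℝ] ℝ) :
    reflEquiv a f = f - (inner ℝ (grad f) (coroot a) : ℝ) • a := rfl

theorem reflEquiv_reflEquiv (a f : E →ᵃ[ℝ] ℝ) : reflEquiv a (reflEquiv a f) = f :=
  reflFun_reflFun a f

theorem reflEquiv_mul_self (a : E →ᵃ[ℝ] ℝ) : reflEquiv a * reflEquiv a = 1 := by
  ext1 f
  exact reflEquiv_reflEquiv a f

theorem reflEquiv_inv (a : E →ᵃ[ℝ] ℝ) : (reflEquiv a)⁻¹ = reflEquiv a :=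
  inv_eq_of_mul_eq_one_left (reflEquiv_mul_self a)

theorem reflEquiv_self {a : E →ᵃ[ℝ] ℝ} (ha : grad a ≠ 0) : reflEquiv a a = -a := by
  rw [reflEquiv_apply, inner_grad_coroot_self ha]
  module

theorem grad_reflEquiv (a f : E →ᵃ[ℝ] ℝ) :
    grad (reflEquiv a f) = grad f - (inner ℝ (grad f) (coroot a) : ℝ) • grad a := by
  rw [reflEquiv_apply, grad_sub, grad_smul]

theorem inner_grad_reflEquiv (a f g : E →ᵃ[ℝ] ℝ) :
    inner ℝ (grad (reflEquiv a f)) (grad (reflEquiv a g)) = (inner ℝ (grad f) (grad g) : ℝ) := by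
  by_cases ha : grad a = 0
  · simp [grad_reflEquiv, ha]
  · have : ‖grad a‖ ≠ 0 := norm_ne_zero_iff.mpr ha
    simp only [grad_reflEquiv, inner_sub_left, inner_sub_right, inner_smul_left, inner_smul_right,
      conj_trivial, inner_coroot, real_inner_self_eq_norm_sq]
    rw [real_inner_comm (grad g) (grad a)]
    field_simp
    ring

/-- The linear automorphisms of the space of functions which preserve scalar products of
gradients. -/
def gradIsometries : Subgroup ((E →ᵃ[ℝ] ℝ) ≃ₗ[ℝ] (E →ᵃ[ℝ] ℝ)) where
  carrier := {w | ∀ f g, (inner ℝ (grad (w f)) (grad (w g)) : ℝ) = inner ℝ (grad f) (grad g)}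
  mul_mem' := fun {u v} hu hv f g => (hu (v f) (v g)).trans (hv f g)
  one_mem' := fun _ _ => rfl
  inv_mem' := fun {u} hu f g => by
    have h := hu (u⁻¹ f) (u⁻¹ g)
    rw [← LinearEquiv.mul_apply, ← LinearEquiv.mul_apply, mul_inv_cancel] at h
    exact h.symm

theorem reflEquiv_mem_gradIsometries (a : E →ᵃ[ℝ] ℝ) : reflEquiv a ∈ gradIsometries (E := E) :=
  inner_grad_reflEquiv a

theorem norm_grad_of_mem {w : (E →ᵃ[ℝ] ℝ) ≃ₗ[ℝ] (E →ᵃ[ℝ] ℝ)} (hw : w ∈ gradIsometries)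
    (f : E →ᵃ[ℝ] ℝ) : ‖grad (w f)‖ = ‖grad f‖ := by
  have h := hw f f
  rw [real_inner_self_eq_norm_sq, real_inner_self_eq_norm_sq] at h
  exact (sq_eq_sq₀ (norm_nonneg _) (norm_nonneg _)).mp h

theorem inner_grad_coroot_of_mem {w : (E →ᵃ[ℝ] ℝ) ≃ₗ[ℝ] (E →ᵃ[ℝ] ℝ)} (hw : w ∈ gradIsometries)
    (f a : E →ᵃ[ℝ] ℝ) :
    (inner ℝ (grad (w f)) (coroot (w a)) : ℝ) = inner ℝ (grad f) (coroot a) := by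
  rw [inner_coroot, inner_coroot, norm_grad_of_mem hw, hw f a]

theorem reflEquiv_map {w : (E →ᵃ[ℝ] ℝ) ≃ₗ[ℝ] (E →ᵃ[ℝ] ℝ)} (hw : w ∈ gradIsometries)
    (a : E →ᵃ[ℝ] ℝ) : reflEquiv (w a) = w * reflEquiv a * w⁻¹ := by
  rw [eq_mul_inv_iff_mul_eq]
  ext1 f
  rw [LinearEquiv.mul_apply, LinearEquiv.mul_apply, reflEquiv_apply, reflEquiv_apply,
    inner_grad_coroot_of_mem hw, map_sub, map_smul]

theorem coroot_reflEquiv (a f : E →ᵃ[ℝ] ℝ) :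
    coroot (reflEquiv a f) = coroot f - (inner ℝ (grad a) (coroot f) : ℝ) • coroot a := by
  have h := norm_grad_of_mem (reflEquiv_mem_gradIsometries a) f
  rw [inner_coroot]
  unfold coroot
  rw [h, grad_reflEquiv, inner_coroot, smul_sub, real_inner_comm (grad a)]
  module

theorem grad_ne_zero_of_mem {w : (E →ᵃ[ℝ] ℝ) ≃ₗ[ℝ] (E →ᵃ[ℝ] ℝ)} (hw : w ∈ gradIsometries)
    {f : E →ᵃ[ℝ] ℝ} (hf : grad f ≠ 0) : grad (w f) ≠ 0 := by
  rw [← norm_ne_zero_iff, norm_grad_of_mem hw]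
  exact norm_ne_zero_iff.mpr hf

/-! ### Obtuse systems of functions -/

/-- A set of affine linear functions, positive at `p`, whose gradients have integral Cartan
numbers and pairwise form non-acute angles. -/
structure IsObtuseSystem (S : Set (E →ᵃ[ℝ] ℝ)) (p : E) : Prop where
  pos : ∀ a ∈ S, 0 < a p
  grad_ne : ∀ a ∈ S, grad a ≠ 0
  integral : ∀ a ∈ S, ∀ b ∈ S, ∃ n : ℤ, inner ℝ (grad a) (coroot b) = (n : ℝ)
  obtuse : ∀ a ∈ S, ∀ b ∈ S, a ≠ b → (inner ℝ (grad a) (grad b) : ℝ) ≤ 0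

theorem nonneg_of_mem_closure {S : Set (E →ᵃ[ℝ] ℝ)} {z : E} (hS : ∀ a ∈ S, 0 ≤ a z)
    {f : E →ᵃ[ℝ] ℝ} (hf : f ∈ AddSubmonoid.closure S) : 0 ≤ f z := by
  induction hf using AddSubmonoid.closure_induction with
  | mem a ha => exact hS a ha
  | zero => simp
  | add f g _ _ h1 h2 => simpa using add_nonneg h1 h2

theorem pos_or_eq_zero_of_mem_closure {S : Set (E →ᵃ[ℝ] ℝ)} {z : E} (hS : ∀ a ∈ S, 0 < a z)
    {f : E →ᵃ[ℝ] ℝ} (hf : f ∈ AddSubmonoid.closure S) : 0 < f z ∨ f = 0 := by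
  induction hf using AddSubmonoid.closure_induction with
  | mem a ha => exact Or.inl (hS a ha)
  | zero => exact Or.inr rfl
  | add f g _ _ h1 h2 =>
    rcases h1 with h1 | rfl
    · rcases h2 with h2 | rfl
      · exact Or.inl (by simpa using add_pos h1 h2)
      · exact Or.inl (by simpa using h1)
    · simpa using h2

/-- Non-negative terms with sum zero at `x` vanish there individually. This localizes positive
combinations to the members of `S` through `x`. -/
theorem mem_closure_of_apply_eq_zero {S : Set (E →ᵃ[ℝ] ℝ)} {x : E} (hS : ∀ a ∈ S, 0 ≤ a x)
    {f : E →ᵃ[ℝ] ℝ} (hf : f ∈ AddSubmonoid.closure S) (hx : f x = 0) :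
    f ∈ AddSubmonoid.closure {a ∈ S | a x = 0} := by
  induction hf using AddSubmonoid.closure_induction with
  | mem a ha => exact AddSubmonoid.subset_closure ⟨ha, hx⟩
  | zero => exact zero_mem _
  | add f g hf hg h1 h2 =>
    have hf0 := nonneg_of_mem_closure hS hf
    have hg0 := nonneg_of_mem_closure hS hg
    have hx' : f x + g x = 0 := by simpa using hx
    exact add_mem (h1 (by linarith)) (h2 (by linarith))

theorem inner_nonpos_of_mem_closure {S : Set (E →ᵃ[ℝ] ℝ)} {v : V}
    (hS : ∀ a ∈ S, (inner ℝ (grad a) v : ℝ) ≤ 0) {f : E →ᵃ[ℝ] ℝ}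
    (hf : f ∈ AddSubmonoid.closure S) : (inner ℝ (grad f) v : ℝ) ≤ 0 := by
  induction hf using AddSubmonoid.closure_induction with
  | mem a ha => exact hS a ha
  | zero => simp [grad_zero]
  | add f g _ _ h1 h2 =>
    rw [grad_add, inner_add_left]
    exact add_nonpos h1 h2

theorem exists_inner_pos {S : Set (E →ᵃ[ℝ] ℝ)} {f : E →ᵃ[ℝ] ℝ}
    (hf : f ∈ AddSubmonoid.closure S) (hg : grad f ≠ 0) :
    ∃ a ∈ S, (0 : ℝ) < inner ℝ (grad a) (grad f) := by
  by_contra! h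
  have h1 := inner_nonpos_of_mem_closure h hf
  rw [real_inner_self_eq_norm_sq] at h1
  have := norm_pos_iff.mpr hg
  nlinarith

theorem exists_nsmul_add_of_mem_closure {S : Set (E →ᵃ[ℝ] ℝ)} (σ : E →ᵃ[ℝ] ℝ)
    {f : E →ᵃ[ℝ] ℝ} (hf : f ∈ AddSubmonoid.closure S) :
    ∃ k : ℕ, ∃ g ∈ AddSubmonoid.closure (S \ {σ}), f = (k : ℝ) • σ + g := by
  induction hf using AddSubmonoid.closure_induction with
  | mem a ha =>
    by_cases h : a = σ
    · exact ⟨1, 0, zero_mem _, by simp [h]⟩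
    · exact ⟨0, a, AddSubmonoid.subset_closure ⟨ha, h⟩, by simp⟩
  | zero => exact ⟨0, 0, zero_mem _, by simp⟩
  | add f g _ _ h1 h2 =>
    obtain ⟨k, f', hf', rfl⟩ := h1
    obtain ⟨l, g', hg', rfl⟩ := h2
    refine ⟨k + l, f' + g', add_mem hf' hg', ?_⟩
    push_cast
    module

/-- The members of an obtuse system are extremal in the cone which they generate. -/
theorem IsObtuseSystem.extremal {S : Set (E →ᵃ[ℝ] ℝ)} {p : E} (hS : IsObtuseSystem S p)
    {σ : E →ᵃ[ℝ] ℝ} (hσ : σ ∈ S) {f g : E →ᵃ[ℝ] ℝ} (hf : f ∈ AddSubmonoid.closure S)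
    (hg : g ∈ AddSubmonoid.closure S) {m : ℝ} (h : f + g = m • σ) : ∃ k : ℕ, f = (k : ℝ) • σ := by
  obtain ⟨k, f', hf', rfl⟩ := exists_nsmul_add_of_mem_closure σ hf
  obtain ⟨l, g', hg', rfl⟩ := exists_nsmul_add_of_mem_closure σ hg
  have hpos : ∀ a ∈ S \ {σ}, 0 < a p := fun a ha => hS.pos a ha.1
  have h1 : f' + g' = (m - k - l) • σ := by
    have : f' + g' = m • σ - (k : ℝ) • σ - (l : ℝ) • σ := by rw [← h]; abel
    rw [this]; module
  have h2 : (inner ℝ (grad (f' + g')) (grad σ) : ℝ) ≤ 0 :=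
    inner_nonpos_of_mem_closure (fun a ha => hS.obtuse a ha.1 σ hσ ha.2) (add_mem hf' hg')
  rw [h1, grad_smul, inner_smul_left, real_inner_self_eq_norm_sq, conj_trivial] at h2
  have h3 : 0 < ‖grad σ‖ ^ 2 := by
    have := norm_pos_iff.mpr (hS.grad_ne σ hσ)
    positivity
  have h4 : m - k - l ≤ 0 := by
    by_contra! h5
    have := mul_pos h5 h3
    linarith
  -- The remainder `f' + g'` is a non-positive multiple of `σ`, hence non-positive at `p`; but its
  -- summands are positive there unless zero.
  have h5 : f' p + g' p = (m - k - l) * σ p := by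
    have := congrArg (fun q : E →ᵃ[ℝ] ℝ => q p) h1
    simpa using this
  have h6 := hS.pos σ hσ
  have h7 := nonneg_of_mem_closure (fun a ha => (hpos a ha).le) hg'
  have h8 : (m - k - l) * σ p ≤ 0 := mul_nonpos_of_nonpos_of_nonneg h4 h6.le
  rcases pos_or_eq_zero_of_mem_closure hpos hf' with h9 | rfl
  · linarith
  · exact ⟨k, by simp⟩

theorem IsObtuseSystem.nat_of_smul_mem {S : Set (E →ᵃ[ℝ] ℝ)} {p : E} (hS : IsObtuseSystem S p)
    {σ : E →ᵃ[ℝ] ℝ} (hσ : σ ∈ S) {c : ℝ} (h : c • σ ∈ AddSubmonoid.closure S) :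
    ∃ k : ℕ, c = k := by
  obtain ⟨k, hk⟩ := hS.extremal hσ h (zero_mem _) (m := c) (by simp)
  refine ⟨k, ?_⟩
  have h1 := congrArg (fun q : E →ᵃ[ℝ] ℝ => q p) hk
  have h2 := hS.pos σ hσ
  simpa [h2.ne'] using h1

/-! ### Word lengths -/

section WordLength

variable {G : Type*} [Group G]

/-- The word length of an element of a group with respect to a set of generators. -/
noncomputable def wordLength (X : Set G) (w : G) : ℕ :=
  sInf {n | ∃ l : List G, (∀ r ∈ l, r ∈ X) ∧ l.prod = w ∧ l.length = n}

theorem wordLength_prod_le {X : Set G} {l : List G} (hl : ∀ r ∈ l, r ∈ X) :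
    wordLength X l.prod ≤ l.length :=
  Nat.sInf_le ⟨l, hl, rfl, rfl⟩

/-- Words use letters of `X` only, hence the closure under inverses. Outside the generated subgroup
no word exists and `wordLength` is the default value 0. -/
theorem exists_reduced_word {X : Set G} (hX : ∀ r ∈ X, r⁻¹ ∈ X) {w : G}
    (hw : w ∈ Subgroup.closure X) :
    ∃ l : List G, (∀ r ∈ l, r ∈ X) ∧ l.prod = w ∧ l.length = wordLength X w := by
  rw [← Subgroup.mem_toSubmonoid, Subgroup.closure_toSubmonoid] at hw
  obtain ⟨l, hl, h⟩ := Submonoid.exists_list_of_mem_closure hw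
  refine Nat.sInf_mem (s := {n | ∃ l : List G, (∀ r ∈ l, r ∈ X) ∧ l.prod = w ∧ l.length = n})
    ⟨l.length, l, fun r hr => ?_, h, rfl⟩
  rcases hl r hr with h1 | h1
  · exact h1
  · simpa using hX _ h1

theorem wordLength_mul_le {X : Set G} (hX : ∀ r ∈ X, r⁻¹ ∈ X) {u v : G}
    (hu : u ∈ Subgroup.closure X) (hv : v ∈ Subgroup.closure X) :
    wordLength X (u * v) ≤ wordLength X u + wordLength X v := by
  obtain ⟨l, hl, rfl, h1⟩ := exists_reduced_word hX hu
  obtain ⟨k, hk, rfl, h2⟩ := exists_reduced_word hX hv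
  rw [← h1, ← h2, ← List.prod_append, ← List.length_append]
  refine wordLength_prod_le fun r hr => ?_
  rcases List.mem_append.mp hr with h | h
  exacts [hl r h, hk r h]

theorem wordLength_mono {X Y : Set G} (hY : ∀ r ∈ Y, r⁻¹ ∈ Y) (h : Y ⊆ X) {w : G}
    (hw : w ∈ Subgroup.closure Y) : wordLength X w ≤ wordLength Y w := by
  obtain ⟨l, hl, rfl, h1⟩ := exists_reduced_word hY hw
  rw [← h1]
  exact wordLength_prod_le fun r hr => h (hl r hr)

theorem wordLength_le_one {X : Set G} {r : G} (hr : r ∈ X) : wordLength X r ≤ 1 := by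
  have h : ∀ s ∈ [r], s ∈ X := by simpa using hr
  simpa using wordLength_prod_le h

end WordLength

/-! ### Positivity of the roots generated by an obtuse system -/

theorem coroot_smul {c : ℝ} (hc : c ≠ 0) (a : E →ᵃ[ℝ] ℝ) : coroot (c • a) = c⁻¹ • coroot a := by
  unfold coroot
  rw [grad_smul, norm_smul, smul_smul, smul_smul, mul_pow, Real.norm_eq_abs, sq_abs]
  congr 1
  by_cases h : ‖grad a‖ = 0
  · simp [h]
  · field_simp

theorem reflEquiv_smul {c : ℝ} (hc : c ≠ 0) (a : E →ᵃ[ℝ] ℝ) :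
    reflEquiv (c • a) = reflEquiv a := by
  ext1 f
  rw [reflEquiv_apply, reflEquiv_apply, coroot_smul hc, inner_smul_right, smul_smul]
  congr 2
  field_simp

/-- The group generated by the reflections in a set of functions, acting on functions. -/
noncomputable def reflGroup (S : Set (E →ᵃ[ℝ] ℝ)) :
    Subgroup ((E →ᵃ[ℝ] ℝ) ≃ₗ[ℝ] (E →ᵃ[ℝ] ℝ)) :=
  Subgroup.closure (reflEquiv '' S)

theorem reflEquiv_mem_reflGroup {S : Set (E →ᵃ[ℝ] ℝ)} {a : E →ᵃ[ℝ] ℝ} (ha : a ∈ S) :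
    reflEquiv a ∈ reflGroup S :=
  Subgroup.subset_closure ⟨a, ha, rfl⟩

theorem reflGroup_mono {S T : Set (E →ᵃ[ℝ] ℝ)} (h : S ⊆ T) : reflGroup S ≤ reflGroup T :=
  Subgroup.closure_mono (Set.image_mono h)

theorem reflGroup_le_gradIsometries (S : Set (E →ᵃ[ℝ] ℝ)) : reflGroup S ≤ gradIsometries := by
  rw [reflGroup, Subgroup.closure_le]
  rintro _ ⟨a, -, rfl⟩
  exact reflEquiv_mem_gradIsometries a

theorem inv_mem_image_reflEquiv (S : Set (E →ᵃ[ℝ] ℝ)) :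
    ∀ r ∈ reflEquiv '' S, r⁻¹ ∈ reflEquiv '' S := by
  rintro _ ⟨a, ha, rfl⟩
  rw [reflEquiv_inv]
  exact ⟨a, ha, rfl⟩

/-- The coefficients of an integral combination of two functions forming an obtuse angle cannot
have opposite signs if the combination is as long as the first function. -/
theorem same_sign_of_norm_eq {a b : E →ᵃ[ℝ] ℝ} (ha : grad a ≠ 0) (hb : grad b ≠ 0)
    (hab : (inner ℝ (grad a) (grad b) : ℝ) ≤ 0) {m n : ℤ}
    (h : ‖grad ((m : ℝ) • a + (n : ℝ) • b)‖ = ‖grad a‖) :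
    (0 ≤ m ∧ 0 ≤ n) ∨ (m ≤ 0 ∧ n ≤ 0) := by
  by_contra! hcon
  have hmn : m * n < 0 := by
    rcases lt_trichotomy m 0 with hm | hm | hm
    · exact mul_neg_of_neg_of_pos hm (hcon.2 hm.le)
    · subst hm
      have h1 := hcon.1 le_rfl
      have h2 := hcon.2 le_rfl
      omega
    · exact mul_neg_of_pos_of_neg hm (hcon.1 hm.le)
  have hm0 : m ≠ 0 := by rintro rfl; simp at hmn
  have hn0 : n ≠ 0 := by rintro rfl; simp at hmn
  have hm1 : (1 : ℝ) ≤ (m : ℝ) ^ 2 := by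
    exact_mod_cast Int.add_one_le_iff.mpr (by positivity : 0 < m ^ 2)
  have hn1 : (0 : ℝ) < (n : ℝ) ^ 2 := by positivity
  have hmnR : (m : ℝ) * n < 0 := by exact_mod_cast hmn
  have hA : 0 < ‖grad a‖ ^ 2 := by have := norm_pos_iff.mpr ha; positivity
  have hB : 0 < ‖grad b‖ ^ 2 := by have := norm_pos_iff.mpr hb; positivity
  have h2 := congrArg (fun t : ℝ => t ^ 2) h
  simp only [grad_add, grad_smul] at h2
  rw [norm_add_sq_real, norm_smul, norm_smul, inner_smul_left, inner_smul_right, mul_pow, mul_pow,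
    Real.norm_eq_abs, Real.norm_eq_abs, sq_abs, sq_abs, conj_trivial] at h2
  -- With `m * n < 0` the cross term only increases the squared norm, which is then at least
  -- `m²‖grad a‖² + n²‖grad b‖²` and exceeds `‖grad a‖²`.
  have h3 : 0 ≤ (m : ℝ) * (n * inner ℝ (grad a) (grad b)) := by
    rw [← mul_assoc]
    exact mul_nonneg_of_nonpos_of_nonpos hmnR.le hab
  have h4 := mul_pos hn1 hB
  have h5 := mul_le_mul_of_nonneg_right hm1 hA.le
  linarith

/-- The exchange condition in rank two. -/
theorem IsObtuseSystem.rank_two_exchange {S : Set (E →ᵃ[ℝ] ℝ)} {p : E} (hS : IsObtuseSystem S p)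
    {a b : E →ᵃ[ℝ] ℝ} (ha : a ∈ S) (hb : b ∈ S) (hab : a ≠ b)
    (l : List ((E →ᵃ[ℝ] ℝ) ≃ₗ[ℝ] (E →ᵃ[ℝ] ℝ))) (hl : ∀ r ∈ l, r ∈ reflEquiv '' {a, b}) :
    (∃ m n : ℕ, l.prod a = (m : ℝ) • a + (n : ℝ) • b) ∨
      ∃ l' : List ((E →ᵃ[ℝ] ℝ) ≃ₗ[ℝ] (E →ᵃ[ℝ] ℝ)), (∀ r ∈ l', r ∈ reflEquiv '' {a, b}) ∧
        l'.prod = l.prod * reflEquiv a ∧ l'.length < l.length := by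
  induction l with
  | nil => exact Or.inl ⟨1, 0, by simp⟩
  | cons r l ih =>
    have hl' : ∀ s ∈ l, s ∈ reflEquiv '' {a, b} := fun s hs => hl s (List.mem_cons_of_mem _ hs)
    have hr := hl r List.mem_cons_self
    rcases ih hl' with ⟨m, n, hmn⟩ | ⟨l', h1, h2, h3⟩
    swap
    · refine Or.inr ⟨r :: l', ?_, ?_, by simpa using h3⟩
      · intro s hs
        rcases List.mem_cons.mp hs with rfl | hs
        exacts [hr, h1 s hs]
      · rw [List.prod_cons, List.prod_cons, h2, mul_assoc]
    have hlG : l.prod ∈ gradIsometries :=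
      list_prod_mem fun s hs => by
        obtain ⟨c, -, rfl⟩ := hl' s hs
        exact reflEquiv_mem_gradIsometries c
    have hrG : r ∈ gradIsometries := by
      obtain ⟨c, -, rfl⟩ := hr
      exact reflEquiv_mem_gradIsometries c
    have hne : l.prod a ≠ 0 := fun h => by
      have := grad_ne_zero_of_mem hlG (hS.grad_ne a ha)
      rw [h] at this
      exact this grad_zero
    -- if the prefix reflects in the line of the current root, it can be moved to the right
    have key : reflEquiv (l.prod a) = r → ∃ l' : List ((E →ᵃ[ℝ] ℝ) ≃ₗ[ℝ] (E →ᵃ[ℝ] ℝ)),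
        (∀ s ∈ l', s ∈ reflEquiv '' {a, b}) ∧
        l'.prod = (r :: l).prod * reflEquiv a ∧ l'.length < (r :: l).length := by
      intro h
      refine ⟨l, hl', ?_, by simp⟩
      rw [List.prod_cons, ← h, reflEquiv_map hlG]
      simp [mul_assoc, reflEquiv_mul_self]
    have hsign : ∀ m' n' : ℤ, (r :: l).prod a = (m' : ℝ) • a + (n' : ℝ) • b →
        (∃ m n : ℕ, (r :: l).prod a = (m : ℝ) • a + (n : ℝ) • b) ∨ (m' ≤ 0 ∧ n' ≤ 0) := by
      intro m' n' h
      rcases same_sign_of_norm_eq (hS.grad_ne a ha) (hS.grad_ne b hb) (hS.obtuse a ha b hb hab)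
        (m := m') (n := n')
        (by rw [← h, List.prod_cons]; exact norm_grad_of_mem (mul_mem hrG hlG) a) with h1 | h1
      · lift m' to ℕ using h1.1
        lift n' to ℕ using h1.2
        exact Or.inl ⟨m', n', by simpa using h⟩
      · exact Or.inr h1
    obtain ⟨c, hc, rfl⟩ := hr
    -- A letter changes only the coefficient of its own function. If both new coefficients are
    -- non-positive, the other one, a natural number, is 0; the current root then lies on the
    -- letter's own line and `key` applies.
    rcases hc with rfl | rfl
    · obtain ⟨k, hk⟩ := hS.integral b hb c ha
      have h1 : (reflEquiv c :: l).prod c = ((-m - n * k : ℤ) : ℝ) • c + ((n : ℤ) : ℝ) • b := by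
        rw [List.prod_cons, LinearEquiv.mul_apply, hmn, map_add, map_smul, map_smul,
          reflEquiv_self (hS.grad_ne c ha), reflEquiv_apply, hk]
        push_cast
        module
      rcases hsign _ _ h1 with h2 | h2
      · exact Or.inl h2
      · right
        apply key
        have hn : n = 0 := by omega
        subst hn
        have hm : (m : ℝ) ≠ 0 := by
          rintro h
          rw [h] at hmn
          exact hne (by simpa using hmn)
        rw [hmn]
        simpa using reflEquiv_smul hm c
    · obtain ⟨k, hk⟩ := hS.integral a ha c hb
      have h1 : (reflEquiv c :: l).prod a = ((m : ℤ) : ℝ) • a + ((-n - m * k : ℤ) : ℝ) • c := by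
        rw [List.prod_cons, LinearEquiv.mul_apply, hmn, map_add, map_smul, map_smul,
          reflEquiv_self (hS.grad_ne c hb), reflEquiv_apply, hk]
        push_cast
        module
      rcases hsign _ _ h1 with h2 | h2
      · exact Or.inl h2
      · right
        apply key
        have hm : m = 0 := by omega
        subst hm
        have hn : (n : ℝ) ≠ 0 := by
          rintro h
          rw [h] at hmn
          exact hne (by simpa using hmn)
        rw [hmn]
        simpa using reflEquiv_smul hn c

/-- The classical induction on length: with `b` the last letter of a reduced word, split `w = v * u`
without gain in length, `u` in the rank two group of `a` and `b`, and `v` as short as possible. Then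
`v` maps `a` and `b` to positive combinations by induction, while `u a` is a natural combination of
`a` and `b` by the rank two case. -/
theorem IsObtuseSystem.map_mem_closure_of_le {S : Set (E →ᵃ[ℝ] ℝ)} {p : E}
    (hS : IsObtuseSystem S p) : ∀ (n : ℕ), ∀ w ∈ reflGroup S, wordLength (reflEquiv '' S) w = n →
      ∀ a ∈ S, wordLength (reflEquiv '' S) w ≤ wordLength (reflEquiv '' S) (w * reflEquiv a) →
      w a ∈ AddSubmonoid.closure S := by
  intro n
  induction n using Nat.strong_induction_on with
  | _ n ih =>
  intro w hw hn a ha hle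
  have hX := inv_mem_image_reflEquiv S
  obtain ⟨l, hl, hlw, hlen⟩ := exists_reduced_word hX hw
  rcases List.eq_nil_or_concat l with rfl | ⟨l₁, t, rfl⟩
  · rw [← hlw]
    exact AddSubmonoid.subset_closure ha
  rw [List.concat_eq_append] at hl hlw hlen
  have hl₁ : ∀ r ∈ l₁, r ∈ reflEquiv '' S := fun r hr => hl r (by simp [hr])
  obtain ⟨b, hb, rfl⟩ := hl t (by simp)
  rw [List.prod_append, List.prod_singleton] at hlw
  rw [List.length_append, List.length_singleton] at hlen
  have hl₁W : l₁.prod ∈ reflGroup S := list_prod_mem fun r hr => Subgroup.subset_closure (hl₁ r hr)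
  have hl₁len := wordLength_prod_le hl₁
  have hba : a ≠ b := by
    rintro rfl
    rw [← hlw, mul_assoc, reflEquiv_mul_self, mul_one, hlw] at hle
    omega
  have hI : ({a, b} : Set (E →ᵃ[ℝ] ℝ)) ⊆ S := by
    rintro _ (rfl | rfl)
    exacts [ha, hb]
  have hXI := inv_mem_image_reflEquiv ({a, b} : Set (E →ᵃ[ℝ] ℝ))
  have haI : reflEquiv a ∈ reflEquiv '' ({a, b} : Set (E →ᵃ[ℝ] ℝ)) := ⟨a, by simp, rfl⟩
  have hbI : reflEquiv b ∈ reflEquiv '' ({a, b} : Set (E →ᵃ[ℝ] ℝ)) := ⟨b, by simp, rfl⟩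
  classical
  let Q : ℕ → Prop := fun k => ∃ v ∈ reflGroup S, ∃ u ∈ reflGroup {a, b}, w = v * u ∧
    wordLength (reflEquiv '' S) v + wordLength (reflEquiv '' {a, b}) u
      ≤ wordLength (reflEquiv '' S) w ∧ wordLength (reflEquiv '' S) v = k
  -- Splitting off the last letter is admissible, so the minimal `v` is strictly shorter than `w`.
  have hQ : Q (wordLength (reflEquiv '' S) l₁.prod) := by
    refine ⟨l₁.prod, hl₁W, reflEquiv b, reflEquiv_mem_reflGroup (by simp), hlw.symm, ?_, rfl⟩
    have := wordLength_le_one hbI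
    omega
  have hQex : ∃ k, Q k := ⟨_, hQ⟩
  have hmin : ∀ k, Q k → Nat.find hQex ≤ k := fun k hk => Nat.find_min' hQex hk
  obtain ⟨v, hv, u, hu, hwvu, hlenvu, hvk⟩ := Nat.find_spec hQex
  have hvlt : wordLength (reflEquiv '' S) v < n := by
    have := hmin _ hQ
    omega
  have hvI : ∀ c ∈ ({a, b} : Set (E →ᵃ[ℝ] ℝ)), v c ∈ AddSubmonoid.closure S := by
    intro c hc
    refine ih _ hvlt v hv rfl c (hI hc) ?_
    -- Otherwise the letter `c` could be moved from `v` to `u`, contradicting the minimality of `v`.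
    by_contra! hlt
    have h1 : Q (wordLength (reflEquiv '' S) (v * reflEquiv c)) := by
      refine ⟨v * reflEquiv c, mul_mem hv (reflEquiv_mem_reflGroup (hI hc)), reflEquiv c * u,
        mul_mem (reflEquiv_mem_reflGroup hc) hu, ?_, ?_, rfl⟩
      · rw [mul_assoc, ← mul_assoc (reflEquiv c), reflEquiv_mul_self, one_mul, hwvu]
      · have h2 := wordLength_mul_le hXI (reflEquiv_mem_reflGroup hc) hu
        have h3 := wordLength_le_one (X := reflEquiv '' ({a, b} : Set (E →ᵃ[ℝ] ℝ)))
          ⟨c, hc, rfl⟩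
        omega
    have := hmin _ h1
    omega
  obtain ⟨k, hk, hku, hklen⟩ := exists_reduced_word hXI hu
  rcases hS.rank_two_exchange ha hb hba k hk with ⟨i, j, hij⟩ | ⟨k', h1, h2, h3⟩
  · rw [hwvu, LinearEquiv.mul_apply, ← hku, hij, map_add, map_smul, map_smul,
      Nat.cast_smul_eq_nsmul, Nat.cast_smul_eq_nsmul]
    exact add_mem (nsmul_mem (hvI a (by simp)) i) (nsmul_mem (hvI b (by simp)) j)
  -- Exchange would make `u * reflEquiv a` shorter than `u`, hence `w * reflEquiv a` shorter than
  -- `w`, against `hle`.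
  · exfalso
    rw [hku] at h2
    have h4 := wordLength_prod_le h1
    rw [h2] at h4
    have hua : u * reflEquiv a ∈ reflGroup {a, b} := mul_mem hu (reflEquiv_mem_reflGroup (by simp))
    have h5 := wordLength_mul_le hX hv (reflGroup_mono hI hua)
    have h6 := wordLength_mono hXI (Set.image_mono hI) hua
    rw [← mul_assoc, ← hwvu] at h5
    omega

/-- Every root generated by an obtuse system is a positive or a negative integral combination
of its members. -/
theorem IsObtuseSystem.map_mem_or_neg_mem {S : Set (E →ᵃ[ℝ] ℝ)} {p : E}
    (hS : IsObtuseSystem S p) {w : (E →ᵃ[ℝ] ℝ) ≃ₗ[ℝ] (E →ᵃ[ℝ] ℝ)} (hw : w ∈ reflGroup S)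
    {a : E →ᵃ[ℝ] ℝ} (ha : a ∈ S) :
    w a ∈ AddSubmonoid.closure S ∨ -(w a) ∈ AddSubmonoid.closure S := by
  rcases le_total (wordLength (reflEquiv '' S) w)
    (wordLength (reflEquiv '' S) (w * reflEquiv a)) with h | h
  · exact Or.inl (hS.map_mem_closure_of_le _ w hw rfl a ha h)
  · right
    have h1 := hS.map_mem_closure_of_le _ (w * reflEquiv a)
      (mul_mem hw (reflEquiv_mem_reflGroup ha)) rfl a ha
      (by rwa [mul_assoc, reflEquiv_mul_self, mul_one])
    rwa [LinearEquiv.mul_apply, reflEquiv_self (hS.grad_ne a ha), map_neg] at h1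

/-- The roots generated by a set of functions. -/
def generatedRoots (S : Set (E →ᵃ[ℝ] ℝ)) : Set (E →ᵃ[ℝ] ℝ) :=
  {f | ∃ w ∈ reflGroup S, ∃ a ∈ S, w a = f}

theorem subset_generatedRoots (S : Set (E →ᵃ[ℝ] ℝ)) : S ⊆ generatedRoots S :=
  fun a ha => ⟨1, one_mem _, a, ha, rfl⟩

theorem map_mem_generatedRoots {S : Set (E →ᵃ[ℝ] ℝ)} {w : (E →ᵃ[ℝ] ℝ) ≃ₗ[ℝ] (E →ᵃ[ℝ] ℝ)}
    (hw : w ∈ reflGroup S) {f : E →ᵃ[ℝ] ℝ} (hf : f ∈ generatedRoots S) :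
    w f ∈ generatedRoots S := by
  obtain ⟨v, hv, a, ha, rfl⟩ := hf
  exact ⟨w * v, mul_mem hw hv, a, ha, rfl⟩

theorem reflEquiv_mem_of_mem_generatedRoots {S : Set (E →ᵃ[ℝ] ℝ)} {f : E →ᵃ[ℝ] ℝ}
    (hf : f ∈ generatedRoots S) : reflEquiv f ∈ reflGroup S := by
  obtain ⟨w, hw, a, ha, rfl⟩ := hf
  rw [reflEquiv_map (reflGroup_le_gradIsometries S hw)]
  exact mul_mem (mul_mem hw (reflEquiv_mem_reflGroup ha)) (inv_mem hw)

/-! ### Signs and reducedness of the generated roots -/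

namespace IsObtuseSystem

variable {S : Set (E →ᵃ[ℝ] ℝ)} {p : E}

theorem grad_ne_of_mem_generatedRoots (hS : IsObtuseSystem S p) {f : E →ᵃ[ℝ] ℝ}
    (hf : f ∈ generatedRoots S) : grad f ≠ 0 := by
  obtain ⟨w, hw, a, ha, rfl⟩ := hf
  exact grad_ne_zero_of_mem (reflGroup_le_gradIsometries S hw) (hS.grad_ne a ha)

theorem neg_mem_generatedRoots (hS : IsObtuseSystem S p) {f : E →ᵃ[ℝ] ℝ}
    (hf : f ∈ generatedRoots S) : -f ∈ generatedRoots S := by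
  rw [← reflEquiv_self (hS.grad_ne_of_mem_generatedRoots hf)]
  exact map_mem_generatedRoots (reflEquiv_mem_of_mem_generatedRoots hf) hf

theorem mem_closure_or_neg_mem (hS : IsObtuseSystem S p) {f : E →ᵃ[ℝ] ℝ}
    (hf : f ∈ generatedRoots S) :
    f ∈ AddSubmonoid.closure S ∨ -f ∈ AddSubmonoid.closure S := by
  obtain ⟨w, hw, a, ha, rfl⟩ := hf
  exact hS.map_mem_or_neg_mem hw ha

/-- A non-zero sum of members is positive wherever all members are. The point `z` is kept arbitrary
so that the statement covers the whole interior of `P`. -/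
theorem pos_or_pos_neg_of_mem_generatedRoots (hS : IsObtuseSystem S p) {f : E →ᵃ[ℝ] ℝ}
    (hf : f ∈ generatedRoots S) {z : E} (hz : ∀ a ∈ S, 0 < a z) :
    (f ∈ AddSubmonoid.closure S ∧ 0 < f z) ∨ (-f ∈ AddSubmonoid.closure S ∧ f z < 0) := by
  have hne : f ≠ 0 := fun h => hS.grad_ne_of_mem_generatedRoots hf (by rw [h, grad_zero])
  rcases hS.mem_closure_or_neg_mem hf with h | h
  · exact Or.inl ⟨h, (pos_or_eq_zero_of_mem_closure hz h).resolve_right hne⟩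
  · have := (pos_or_eq_zero_of_mem_closure hz h).resolve_right (neg_ne_zero.mpr hne)
    exact Or.inr ⟨h, by simpa using this⟩

theorem mem_closure_of_pos (hS : IsObtuseSystem S p) {f : E →ᵃ[ℝ] ℝ}
    (hf : f ∈ generatedRoots S) (hp : 0 < f p) : f ∈ AddSubmonoid.closure S := by
  rcases hS.pos_or_pos_neg_of_mem_generatedRoots hf hS.pos with h | h
  · exact h.1
  · linarith [h.2]

theorem nat_of_smul_mem_generatedRoots (hS : IsObtuseSystem S p) {a : E →ᵃ[ℝ] ℝ} (ha : a ∈ S)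
    {c : ℝ} (hc : 0 < c) (h : c • a ∈ generatedRoots S) : ∃ k : ℕ, c = k :=
  hS.nat_of_smul_mem ha (hS.mem_closure_of_pos h (by simpa using mul_pos hc (hS.pos a ha)))

/-- If `c • a = w b`, then `c⁻¹ • b = w⁻¹ a` is a generated root too, so both `c` and `c⁻¹` are
natural numbers. -/
theorem eq_one_of_smul_mem (hS : IsObtuseSystem S p) {a : E →ᵃ[ℝ] ℝ} (ha : a ∈ S)
    {c : ℝ} (hc : 0 < c) (h : c • a ∈ generatedRoots S) : c = 1 := by
  obtain ⟨k, hk⟩ := hS.nat_of_smul_mem_generatedRoots ha hc h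
  obtain ⟨w, hw, b, hb, hwb⟩ := h
  have h1 : c⁻¹ • b = w⁻¹ a := by
    have h2 : w⁻¹ (w b) = b := by rw [← LinearEquiv.mul_apply, inv_mul_cancel]; rfl
    rw [← h2, hwb, map_smul, smul_smul, inv_mul_cancel₀ hc.ne', one_smul]
  obtain ⟨j, hj⟩ := hS.nat_of_smul_mem_generatedRoots hb (inv_pos.mpr hc)
    (h1 ▸ ⟨w⁻¹, inv_mem hw, a, ha, rfl⟩)
  have h3 : (k : ℝ) * j = 1 := by rw [← hk, ← hj, mul_inv_cancel₀ hc.ne']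
  have h4 : k * j = 1 := by exact_mod_cast h3
  rw [hk, Nat.eq_one_of_mul_eq_one_right h4, Nat.cast_one]

theorem reduced_generatedRoots (hS : IsObtuseSystem S p) {f : E →ᵃ[ℝ] ℝ}
    (hf : f ∈ generatedRoots S) :
    {g | ∃ c : ℝ, g = c • f} ∩ generatedRoots S = {f, -f} := by
  refine Set.Subset.antisymm ?_ ?_
  · rintro _ ⟨⟨c, rfl⟩, hc⟩
    obtain ⟨w, hw, a, ha, rfl⟩ := hf
    have h1 : c • a ∈ generatedRoots S := by
      have := map_mem_generatedRoots (inv_mem hw) hc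
      rwa [map_smul, ← LinearEquiv.mul_apply, inv_mul_cancel] at this
    rcases lt_trichotomy c 0 with h | rfl | h
    · have h2 := hS.neg_mem_generatedRoots h1
      rw [← neg_smul] at h2
      have h3 := hS.eq_one_of_smul_mem ha (neg_pos.mpr h) h2
      right
      rw [Set.mem_singleton_iff, ← neg_neg c, h3, neg_smul, one_smul]
    · exact absurd (by simp [grad_zero]) (hS.grad_ne_of_mem_generatedRoots h1)
    · left
      rw [hS.eq_one_of_smul_mem ha h h1, one_smul]
  · rintro g (rfl | rfl)
    · exact ⟨⟨1, by simp⟩, hf⟩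
    · exact ⟨⟨-1, by simp⟩, hS.neg_mem_generatedRoots hf⟩

end IsObtuseSystem

/-! ### Lattices -/

theorem sub_int_smul_mem_dualLattice {L : AddSubgroup V} {χ ψ : V} (hχ : χ ∈ dualLattice L)
    (hψ : ψ ∈ dualLattice L) (n : ℤ) : χ - (n : ℝ) • ψ ∈ dualLattice L := by
  intro v hv
  obtain ⟨i, hi⟩ := hχ v hv
  obtain ⟨j, hj⟩ := hψ v hv
  exact ⟨i - n * j, by rw [inner_sub_right, inner_smul_right, hi, hj]; push_cast; ring⟩

/-- Some `v` in a finite spanning subset of `L` is not orthogonal to `grad f`. Its pairing with the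
coroot is a non-zero integer of absolute value at most `2‖v‖ / ‖grad f‖`, whence `‖grad f‖ ≤ 2‖v‖`.
-/
theorem exists_norm_le_of_coroot_mem {L : AddSubgroup V} (hL : IsLattice L) :
    ∃ C : ℝ, ∀ f : E →ᵃ[ℝ] ℝ, coroot f ∈ dualLattice L → ‖grad f‖ ≤ C := by
  obtain ⟨t, htL, -, ht, -⟩ := Submodule.exists_finset_span_eq_linearIndepOn ℝ (L : Set V)
  rw [hL.span_eq_top] at ht
  refine ⟨2 * ∑ v ∈ t, ‖v‖, fun f hf => ?_⟩
  have hsum : 0 ≤ ∑ v ∈ t, ‖v‖ := Finset.sum_nonneg fun v _ => norm_nonneg v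
  by_cases h0 : grad f = 0
  · rw [h0, norm_zero]
    positivity
  have hpos := norm_pos_iff.mpr h0
  have hv : ∃ v ∈ t, (inner ℝ v (grad f) : ℝ) ≠ 0 := by
    by_contra! h
    apply h0
    have h1 : grad f ∈ (Submodule.span ℝ (t : Set V))ᗮ := by
      rw [Submodule.mem_orthogonal]
      intro u hu
      induction hu using Submodule.span_induction with
      | mem u hu => exact h u hu
      | zero => exact inner_zero_left _
      | add u v _ _ hu hv => rw [inner_add_left, hu, hv, add_zero]
      | smul c u _ hu => rw [inner_smul_left, hu, mul_zero]
    rwa [ht, Submodule.top_orthogonal_eq_bot, Submodule.mem_bot] at h1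
  obtain ⟨v, hvt, hv0⟩ := hv
  obtain ⟨n, hn⟩ := hf v (htL hvt)
  rw [inner_coroot] at hn
  have hn0 : n ≠ 0 := by
    rintro rfl
    have : 2 / ‖grad f‖ ^ 2 ≠ 0 := by positivity
    simp [this, hv0] at hn
  have h1 : (1 : ℝ) ≤ |(n : ℝ)| := by exact_mod_cast Int.one_le_abs hn0
  have h2 : |(n : ℝ)| ≤ 2 / ‖grad f‖ ^ 2 * (‖v‖ * ‖grad f‖) := by
    rw [← hn, abs_mul, abs_of_pos (by positivity : 0 < 2 / ‖grad f‖ ^ 2)]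
    exact mul_le_mul_of_nonneg_left (abs_real_inner_le_norm _ _) (by positivity)
  have h3 : 2 / ‖grad f‖ ^ 2 * (‖v‖ * ‖grad f‖) = 2 * ‖v‖ / ‖grad f‖ := by field_simp
  rw [h3] at h2
  have h4 := (le_div_iff₀ hpos).mp (h1.trans h2)
  have h5 : ‖v‖ ≤ ∑ v ∈ t, ‖v‖ := Finset.single_le_sum (fun v _ => norm_nonneg v) hvt
  linarith

theorem finite_grad_image {L : AddSubgroup V} (hL : IsLattice L) {Φ : Set (E →ᵃ[ℝ] ℝ)}
    (h : ∀ f ∈ Φ, grad f ∈ L ∧ coroot f ∈ dualLattice L) : (grad '' Φ).Finite := by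
  obtain ⟨C, hC⟩ := exists_norm_le_of_coroot_mem (E := E) hL
  have := hL.discrete
  refine (Metric.finite_isBounded_inter_isClosed (s := (L : Set V)) DiscreteTopology.isDiscrete
    (Metric.isBounded_closedBall (x := (0 : V)) (r := C))
    AddSubgroup.isClosed_of_discrete).subset ?_
  rintro _ ⟨f, hf, rfl⟩
  exact ⟨by simpa using hC f (h f hf).2, (h f hf).1⟩

theorem map_mem_of_reflEquiv_stable {S Q : Set (E →ᵃ[ℝ] ℝ)}
    (hQ : ∀ a ∈ S, ∀ f ∈ Q, reflEquiv a f ∈ Q) {w : (E →ᵃ[ℝ] ℝ) ≃ₗ[ℝ] (E →ᵃ[ℝ] ℝ)}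
    (hw : w ∈ reflGroup S) {f : E →ᵃ[ℝ] ℝ} (hf : f ∈ Q) : w f ∈ Q := by
  obtain ⟨l, hl, rfl, -⟩ := exists_reduced_word (inv_mem_image_reflEquiv S) hw
  induction l with
  | nil => exact hf
  | cons r l ih =>
    obtain ⟨a, ha, rfl⟩ := hl r List.mem_cons_self
    rw [List.prod_cons, LinearEquiv.mul_apply]
    have hl' : ∀ s ∈ l, s ∈ reflEquiv '' S := fun s hs => hl s (List.mem_cons_of_mem _ hs)
    exact hQ a ha _ (ih hl' (list_prod_mem fun s hs => Subgroup.subset_closure (hl' s hs)))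

theorem weight_of_mem_generatedRoots {L : AddSubgroup V} {S : Set (E →ᵃ[ℝ] ℝ)}
    (hS : ∀ a ∈ S, grad a ∈ L ∧ coroot a ∈ dualLattice L) {f : E →ᵃ[ℝ] ℝ}
    (hf : f ∈ generatedRoots S) : grad f ∈ L ∧ coroot f ∈ dualLattice L := by
  obtain ⟨w, hw, a, ha, rfl⟩ := hf
  refine map_mem_of_reflEquiv_stable (Q := {f | grad f ∈ L ∧ coroot f ∈ dualLattice L})
    (fun b hb f hf => ?_) hw (hS a ha)
  obtain ⟨n, hn⟩ := (hS b hb).2 (grad f) hf.1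
  obtain ⟨m, hm⟩ := hf.2 (grad b) (hS b hb).1
  refine ⟨?_, ?_⟩
  · rw [grad_reflEquiv, hn, Int.cast_smul_eq_zsmul]
    exact sub_mem hf.1 (zsmul_mem (hS b hb).1 n)
  · rw [coroot_reflEquiv, hm]
    exact sub_int_smul_mem_dualLattice hf.2 (hS b hb).2 m

/-! ### Affine root systems -/

namespace IsAffineRootSystem

variable {Φ : Set (E →ᵃ[ℝ] ℝ)}

theorem grad_ne (hΦ : IsAffineRootSystem Φ) {α : E →ᵃ[ℝ] ℝ} (hα : α ∈ Φ) : grad α ≠ 0 := by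
  intro h
  refine hΦ.nonconst α hα (α (Classical.arbitrary E)) ?_
  ext z
  rw [← vsub_vadd z (Classical.arbitrary E), apply_vadd, h]
  simp

theorem neg_mem (hΦ : IsAffineRootSystem Φ) {α : E →ᵃ[ℝ] ℝ} (hα : α ∈ Φ) : -α ∈ Φ := by
  have h : -α ∈ {β | ∃ c : ℝ, β = c • α} ∩ Φ := by
    rw [hΦ.reduced α hα]
    exact Or.inr rfl
  exact h.2

theorem reflEquiv_mem (hΦ : IsAffineRootSystem Φ) {α β : E →ᵃ[ℝ] ℝ} (hα : α ∈ Φ) (hβ : β ∈ Φ) :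
    reflEquiv α β ∈ Φ := by
  have h : reflFun α β ∈ Φ := by
    rw [← hΦ.stable α hα]
    exact ⟨β, hβ, rfl⟩
  exact h

end IsAffineRootSystem

theorem IsObtuseSystem.isIntegralAffineRootSystem {S : Set (E →ᵃ[ℝ] ℝ)} {p : E}
    (hS : IsObtuseSystem S p) {L : AddSubgroup V} (hL : IsLattice L)
    (hSL : ∀ a ∈ S, grad a ∈ L ∧ coroot a ∈ dualLattice L) :
    IsIntegralAffineRootSystem (generatedRoots S) L where
  rootSystem :=
    { nonconst := by
        rintro α hα c rfl
        refine hS.grad_ne_of_mem_generatedRoots hα (ext_inner_right ℝ fun t => ?_)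
        rw [inner_grad]
        simp
      reduced := fun α hα => hS.reduced_generatedRoots hα
      integral := fun α hα β hβ => (weight_of_mem_generatedRoots hSL hβ).2 _
        (weight_of_mem_generatedRoots hSL hα).1
      stable := fun α hα => by
        have h : ∀ f ∈ generatedRoots S, reflFun α f ∈ generatedRoots S := fun f hf =>
          map_mem_generatedRoots (reflEquiv_mem_of_mem_generatedRoots hα) hf
        refine Set.Subset.antisymm ?_ fun f hf => ⟨reflFun α f, h f hf, reflFun_reflFun α f⟩
        rintro _ ⟨f, hf, rfl⟩
        exact h f hf
      finite_grad := finite_grad_image hL fun _ hf => weight_of_mem_generatedRoots hSL hf }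
  lattice := hL
  grad_mem := fun _ hα => (weight_of_mem_generatedRoots hSL hα).1
  coroot_mem := fun _ hα => (weight_of_mem_generatedRoots hSL hα).2

/-! ### Induction over finite sets of functions -/

/-- The value at `p` serves as a height; finiteness of `X` makes it well-founded. -/
theorem finite_value_induction {X : Set (E →ᵃ[ℝ] ℝ)} (hX : X.Finite) (p : E)
    {Q : (E →ᵃ[ℝ] ℝ) → Prop} (h : ∀ a ∈ X, (∀ b ∈ X, b p < a p → Q b) → Q a) :
    ∀ a ∈ X, Q a := by
  by_contra! hcon
  obtain ⟨a, ha, hQ⟩ := hcon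
  obtain ⟨m, hm⟩ := (hX.subset (Set.sep_subset X fun b => ¬ Q b)).exists_minimalFor
    (fun f : E →ᵃ[ℝ] ℝ => f p) _ ⟨a, ha, hQ⟩
  refine hm.1.2 (h m hm.1.1 fun b hb hlt => ?_)
  by_contra hb'
  exact absurd (hm.2 ⟨hb, hb'⟩ hlt.le) (not_le.mpr hlt)

theorem finite_of_finite_grad {X : Set (E →ᵃ[ℝ] ℝ)} {x : E} (hx : ∀ f ∈ X, f x = 0)
    (hX : (grad '' X).Finite) : X.Finite :=
  hX.of_finite_image fun f hf g hg h => eq_of_grad_eq h ((hx f hf).trans (hx g hg).symm)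

/-- A finite system of roots through `x` which are positive or negative combinations of `S` is
obtained by reflections from multiples of members of `S`. -/
theorem IsObtuseSystem.mem_of_reflEquiv_stable {S : Set (E →ᵃ[ℝ] ℝ)} {p x : E}
    (hS : IsObtuseSystem S p) (hx : ∀ a ∈ S, 0 ≤ a x) {X Y : Set (E →ᵃ[ℝ] ℝ)} (hX : X.Finite)
    (hX0 : ∀ f ∈ X, f x = 0) (hXg : ∀ f ∈ X, grad f ≠ 0)
    (hXs : ∀ f ∈ X, (f ∈ AddSubmonoid.closure S ∧ 0 < f p) ∨
      (-f ∈ AddSubmonoid.closure S ∧ f p < 0))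
    (hXr : ∀ a ∈ S, a x = 0 → ∀ f ∈ X, reflEquiv a f ∈ X)
    (hYr : ∀ a ∈ S, a x = 0 → ∀ f ∈ Y, reflEquiv a f ∈ Y)
    (hXY : ∀ a ∈ S, a x = 0 → ∀ c : ℝ, 0 < c → c • a ∈ X → c • a ∈ Y) :
    ∀ f ∈ X, 0 < f p → f ∈ Y := by
  refine finite_value_induction hX p fun f hf ih hfp => ?_
  have hfS : f ∈ AddSubmonoid.closure S := by
    rcases hXs f hf with h | h
    · exact h.1
    · linarith [h.2]
  obtain ⟨a, ⟨ha, hax⟩, hpos⟩ :=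
    exists_inner_pos (mem_closure_of_apply_eq_zero hx hfS (hX0 f hf)) (hXg f hf)
  have hm : (0 : ℝ) < inner ℝ (grad f) (coroot a) := by
    have := norm_pos_iff.mpr (hS.grad_ne a ha)
    rw [inner_coroot, real_inner_comm]
    positivity
  have hg := hXr a ha hax f hf
  rcases hXs _ hg with h | h
  · rw [← reflEquiv_reflEquiv a f]
    refine hYr a ha hax _ (ih _ hg ?_ h.2)
    rw [reflEquiv_apply]
    have := mul_pos hm (hS.pos a ha)
    simpa using this
  -- Here the reflection turns `f` negative. As `f + (-(s_a f))` is a multiple of `a`, extremality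
  -- makes `f` itself a multiple of `a`.
  · obtain ⟨k, hk⟩ := hS.extremal ha hfS h.1 (m := inner ℝ (grad f) (coroot a))
      (by rw [reflEquiv_apply]; abel)
    rw [hk] at hf hfp ⊢
    refine hXY a ha hax k ?_ hf
    have h1 : 0 < (k : ℝ) * a p := by simpa using hfp
    exact pos_of_mul_pos_left h1 (hS.pos a ha).le

/-! ### Convex solid sets -/

theorem continuous_affineMap (f : E →ᵃ[ℝ] ℝ) : Continuous f := by
  have h : (f : E → ℝ) = fun z => f (Classical.arbitrary E) +
      inner ℝ (grad f) (z -ᵥ Classical.arbitrary E) := by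
    ext z
    rw [← apply_vadd, vsub_vadd]
  rw [h]
  fun_prop

theorem IsConvex.isPreconnected_interior {P : Set E} (hP : IsConvex P) :
    IsPreconnected (interior P) := by
  let h : V ≃ₜ E := (IsometryEquiv.vaddConst (Classical.arbitrary E)).toHomeomorph
  have hconv : Convex ℝ (h ⁻¹' P) := by
    rw [convex_iff_segment_subset]
    intro u hu v hv z hz
    rw [segment_eq_image_lineMap] at hz
    obtain ⟨t, ht, rfl⟩ := hz
    refine hP _ hu _ hv ⟨t, ht, ?_⟩
    exact ((AffineEquiv.vaddConst ℝ (Classical.arbitrary E)).apply_lineMap u v t).symm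
  have h1 : interior P = h '' interior (h ⁻¹' P) := by
    rw [h.image_interior, h.image_preimage]
  rw [h1]
  exact hconv.interior.isPreconnected.image _ h.continuous.continuousOn

theorem eventually_smul_vadd_mem_interior {P : Set E} {z : E} (hz : z ∈ interior P) (v : V) :
    ∀ᶠ t : ℝ in 𝓝 0, t • v +ᵥ z ∈ interior P := by
  have hc : Continuous fun t : ℝ => t • v +ᵥ z := by fun_prop
  exact hc.continuousAt.eventually (isOpen_interior.mem_nhds (by simpa using hz))

theorem exists_smul_vadd_mem_interior {P : Set E} {z : E} (hz : z ∈ interior P) (v : V) :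
    ∃ t : ℝ, 0 < t ∧ t • v +ᵥ z ∈ interior P ∧ (-t) • v +ᵥ z ∈ interior P := by
  have h1 := eventually_smul_vadd_mem_interior hz v
  have h2 := eventually_smul_vadd_mem_interior hz (-v)
  have h3 : ∀ᶠ t : ℝ in 𝓝[>] 0, 0 < t := self_mem_nhdsWithin
  obtain ⟨t, ht, h4, h5⟩ :=
    (h3.and ((h1.filter_mono nhdsWithin_le_nhds).and (h2.filter_mono nhdsWithin_le_nhds))).exists
  exact ⟨t, ht, h4, by simpa using h5⟩

theorem pos_of_mem_interior {P : Set E} {α : E →ᵃ[ℝ] ℝ} (hα : grad α ≠ 0)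
    (h : ∀ z ∈ P, 0 ≤ α z) {z : E} (hz : z ∈ interior P) : 0 < α z := by
  obtain ⟨t, ht, -, h1⟩ := exists_smul_vadd_mem_interior hz (grad α)
  have h2 := h _ (interior_subset h1)
  rw [apply_vadd, inner_smul_right, real_inner_self_eq_norm_sq] at h2
  have h3 := norm_pos_iff.mpr hα
  have : 0 < t * ‖grad α‖ ^ 2 := by positivity
  linarith

/-- The interior of a convex set is connected, so `f` has constant sign there; solidity extends it
to `P` by closure. -/
theorem nonneg_or_nonpos_of_ne_zero {P : Set E} (hP : IsConvex P) (hsolid : IsSolid P)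
    {f : E →ᵃ[ℝ] ℝ} (hf : ∀ z ∈ interior P, f z ≠ 0) :
    (∀ z ∈ P, 0 ≤ f z) ∨ (∀ z ∈ P, f z ≤ 0) := by
  have hc := continuous_affineMap f
  have hcl : ∀ {C : Set E}, IsClosed C → interior P ⊆ C → P ⊆ C := fun hC h =>
    hsolid.2.trans (closure_minimal h hC)
  by_cases h : ∀ z ∈ interior P, 0 ≤ f z
  · exact Or.inl (hcl (isClosed_le continuous_const hc) h)
  · push Not at h
    obtain ⟨z, hz, hfz⟩ := h
    refine Or.inr (hcl (isClosed_le hc continuous_const) fun y hy => ?_)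
    by_contra hfy
    obtain ⟨u, hu, hfu⟩ := hP.isPreconnected_interior.intermediate_value hz hy hc.continuousOn
      ⟨hfz.le, (not_le.mp hfy).le⟩
    exact hf u hu hfu

/-! ### Local root systems -/

theorem refl_mem_generatedGroup {P : Set E} {Φ : P → Set (E →ᵃ[ℝ] ℝ)} {x : P} {α : E →ᵃ[ℝ] ℝ}
    (hα : α ∈ Φ x) : refl α ∈ generatedGroup P Φ :=
  (le_iSup (fun x : P => weylGroup (Φ x)) x) (Subgroup.subset_closure ⟨α, hα, rfl⟩)

/-- Shows that the reflection in `s_a b` belongs to the generated group even when `s_a b` is not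
known to be a local root. -/
theorem refl_refl_refl_apply (a b : E →ᵃ[ℝ] ℝ) (z : E) :
    refl a (refl b (refl a z)) = refl (reflEquiv a b) z := by
  have h1 : b (refl a z) = reflEquiv a b z := (reflFun_apply a b z).symm
  rw [refl_apply b, h1]
  simp only [refl_apply, vadd_vadd, apply_vadd, coroot_reflEquiv]
  by_cases ha : grad a = 0
  · simp [coroot_eq_zero ha]
  congr 1
  rw [inner_add_right, inner_neg_right, inner_neg_right, inner_smul_right, inner_smul_right,
    inner_grad_coroot_self ha]
  module

namespace IsLocalRootSystem

variable {P : Set E} {Φ : P → Set (E →ᵃ[ℝ] ℝ)} {L : AddSubgroup V}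

theorem apply_eq_zero (hΦ : IsLocalRootSystem P Φ L) {x : P} {α : E →ᵃ[ℝ] ℝ} (hα : α ∈ Φ x) :
    α x = 0 := by
  have h := (hΦ.locally_eq x).self_of_nhds
  rw [h] at hα
  exact hα.2

theorem grad_ne (hΦ : IsLocalRootSystem P Φ L) {x : P} {α : E →ᵃ[ℝ] ℝ} (hα : α ∈ Φ x) :
    grad α ≠ 0 :=
  (hΦ.integral x).rootSystem.grad_ne hα

theorem finite (hΦ : IsLocalRootSystem P Φ L) (x : P) : (Φ x).Finite :=
  finite_of_finite_grad (fun _ hf => hΦ.apply_eq_zero hf) (hΦ.integral x).rootSystem.finite_grad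

/-- A local root belongs to the local system of every point of `P` on its hyperplane. -/
theorem mem_of_apply_eq_zero (hΦ : IsLocalRootSystem P Φ L) (hP : IsConvex P) {x y : P}
    {α : E →ᵃ[ℝ] ℝ} (hα : α ∈ Φ y) (hx : α x = 0) : α ∈ Φ x := by
  let γ : unitInterval → P := fun t =>
    ⟨AffineMap.lineMap (y : E) (x : E) (t : ℝ), hP _ y.2 _ x.2 ⟨t, t.2, rfl⟩⟩
  have hγ : Continuous γ :=
    Continuous.subtype_mk (AffineMap.lineMap_continuous.comp continuous_subtype_val) _
  have h0 : ∀ t, α (γ t) = 0 := fun t => by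
    change α (AffineMap.lineMap (y : E) (x : E) (t : ℝ)) = 0
    rw [AffineMap.apply_lineMap, hΦ.apply_eq_zero hα, hx]
    simp
  -- Since `α` vanishes along the whole segment, axiom (2) makes membership in the local systems
  -- locally constant along it.
  have hloc : IsLocallyConstant fun t => α ∈ Φ (γ t) := by
    rw [IsLocallyConstant.iff_eventually_eq]
    intro t
    filter_upwards [hγ.continuousAt.eventually (hΦ.locally_eq (γ t))] with s hs
    rw [hs]
    exact propext ⟨fun h => h.1, fun h => ⟨h, h0 s⟩⟩
  have h1 := hloc.apply_eq_of_preconnectedSpace 0 1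
  have hγ0 : γ 0 = y := Subtype.ext (by simp [γ])
  have hγ1 : γ 1 = x := Subtype.ext (by simp [γ])
  simp only [hγ0, hγ1] at h1
  exact h1 ▸ hα

end IsLocalRootSystem

/-- The roots of a family which are non-negative on `P`. -/
def positiveRoots (P : Set E) (Φ : P → Set (E →ᵃ[ℝ] ℝ)) : Set (E →ᵃ[ℝ] ℝ) :=
  {α | (∃ x, α ∈ Φ x) ∧ ∀ z ∈ P, 0 ≤ α z}

/-- The positive roots which are not a sum of two positive roots. -/
def simpleRoots (P : Set E) (Φ : P → Set (E →ᵃ[ℝ] ℝ)) : Set (E →ᵃ[ℝ] ℝ) :=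
  {α ∈ positiveRoots P Φ | ∀ β ∈ positiveRoots P Φ, ∀ γ ∈ positiveRoots P Φ, α ≠ β + γ}

/-! ### Simple roots of a local root system -/

namespace IsLocalRootSystem

variable {P : Set E} {Φ : P → Set (E →ᵃ[ℝ] ℝ)} {L : AddSubgroup V}

theorem mem_positiveRoots_or_neg_mem (hΦ : IsLocalRootSystem P Φ L) {x : P} {α : E →ᵃ[ℝ] ℝ}
    (hα : α ∈ Φ x) : α ∈ positiveRoots P Φ ∨ -α ∈ positiveRoots P Φ := by
  rcases hΦ.sign x α hα with h | h
  · exact Or.inl ⟨⟨x, hα⟩, h⟩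
  · exact Or.inr ⟨⟨x, (hΦ.integral x).rootSystem.neg_mem hα⟩, fun z hz => by simpa using h z hz⟩

theorem pos_of_mem_positiveRoots (hΦ : IsLocalRootSystem P Φ L) {α : E →ᵃ[ℝ] ℝ}
    (hα : α ∈ positiveRoots P Φ) {z : E} (hz : z ∈ interior P) : 0 < α z := by
  obtain ⟨⟨x, hx⟩, h⟩ := hα
  exact pos_of_mem_interior (hΦ.grad_ne hx) h hz

theorem weight_of_mem (hΦ : IsLocalRootSystem P Φ L) {x : P} {α : E →ᵃ[ℝ] ℝ} (hα : α ∈ Φ x) :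
    grad α ∈ L ∧ coroot α ∈ dualLattice L :=
  ⟨(hΦ.integral x).grad_mem α hα, (hΦ.integral x).coroot_mem α hα⟩

/-- Reflections of local roots in local roots do not vanish inside `P`. -/
theorem reflEquiv_ne_zero (hΦ : IsLocalRootSystem P Φ L)
    (horb : ∀ z : E, (orbit (generatedGroup P Φ) z ∩ P).Subsingleton) {x y : P}
    {a b : E →ᵃ[ℝ] ℝ} (ha : a ∈ Φ x) (hb : b ∈ Φ y) {z : E} (hz : z ∈ interior P) :
    reflEquiv a b z ≠ 0 := by
  intro h0
  set γ := reflEquiv a b with hγ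
  have hg : grad γ ≠ 0 := grad_ne_zero_of_mem (reflEquiv_mem_gradIsometries a) (hΦ.grad_ne hb)
  have hg2 : 0 < ‖grad γ‖ ^ 2 := by
    have := norm_pos_iff.mpr hg
    positivity
  -- Two points of `P` placed symmetrically about the hyperplane of `γ`; the reflection exchanges
  -- them, so they share an orbit.
  obtain ⟨t, ht, h1, h2⟩ := exists_smul_vadd_mem_interior hz (grad γ)
  have h3 : γ (t • grad γ +ᵥ z) = t * ‖grad γ‖ ^ 2 := by
    rw [apply_vadd, h0, inner_smul_right, real_inner_self_eq_norm_sq, zero_add]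
  have h4 : refl γ (t • grad γ +ᵥ z) = (-t) • grad γ +ᵥ z := by
    rw [refl_apply, h3, vadd_vadd]
    congr 1
    rw [coroot, smul_smul, ← neg_smul, ← add_smul]
    congr 1
    field_simp
    ring
  have hra := refl_mem_generatedGroup ha
  have hrb := refl_mem_generatedGroup hb
  have h5 : (-t) • grad γ +ᵥ z = t • grad γ +ᵥ z := by
    refine horb (t • grad γ +ᵥ z) ⟨⟨refl a * refl b * refl a, mul_mem (mul_mem hra hrb) hra, ?_⟩,
      interior_subset h2⟩ ⟨⟨1, one_mem _, rfl⟩, interior_subset h1⟩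
    rw [← h4, hγ, ← refl_refl_refl_apply]
    rfl
  have h6 : (-t) • grad γ = t • grad γ := vadd_right_cancel z h5
  have h7 : (2 * t) • grad γ = 0 := by
    rw [two_mul, add_smul]
    nth_rewrite 1 [← h6]
    module
  rcases smul_eq_zero.mp h7 with h8 | h8
  · linarith
  · exact hg h8

/-- Otherwise `s_a b = b - a` has constant sign on `P`. If it is non-negative, `a` vanishes at a
point `y` with `b ∈ Φ y`; then `b - a ∈ Φ y` and `b = a + (b - a)` is decomposable. If it is
non-positive, `a` decomposes likewise. -/
theorem inner_coroot_ne_one (hΦ : IsLocalRootSystem P Φ L) (hP : IsConvex P) (hsolid : IsSolid P)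
    (horb : ∀ z : E, (orbit (generatedGroup P Φ) z ∩ P).Subsingleton) {a b : E →ᵃ[ℝ] ℝ}
    (ha : a ∈ simpleRoots P Φ) (hb : b ∈ simpleRoots P Φ) :
    (inner ℝ (grad b) (coroot a) : ℝ) ≠ 1 := by
  intro h
  obtain ⟨⟨⟨x, hax⟩, ha0⟩, hai⟩ := ha
  obtain ⟨⟨⟨y, hby⟩, hb0⟩, hbi⟩ := hb
  have hγ : reflEquiv a b = b - a := by rw [reflEquiv_apply, h, one_smul]
  have hne : ∀ z ∈ interior P, reflEquiv a b z ≠ 0 := fun z hz =>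
    hΦ.reflEquiv_ne_zero horb hax hby hz
  have hsign := nonneg_or_nonpos_of_ne_zero hP hsolid hne
  rw [hγ] at hsign
  rcases hsign with hs | hs
  · have h1 : 0 ≤ b y - a y := by simpa using hs y y.2
    rw [hΦ.apply_eq_zero hby] at h1
    have h2 : a ∈ Φ y := hΦ.mem_of_apply_eq_zero hP hax (by linarith [ha0 y y.2])
    have h3 := (hΦ.integral y).rootSystem.reflEquiv_mem h2 hby
    rw [hγ] at h3
    exact hbi a ⟨⟨x, hax⟩, ha0⟩ (b - a) ⟨⟨y, h3⟩, hs⟩ (by abel)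
  · have h1 : b x - a x ≤ 0 := by simpa using hs x x.2
    rw [hΦ.apply_eq_zero hax] at h1
    have h2 : b ∈ Φ x := hΦ.mem_of_apply_eq_zero hP hby (by linarith [hb0 x x.2])
    have h3 := (hΦ.integral x).rootSystem.neg_mem
      ((hΦ.integral x).rootSystem.reflEquiv_mem hax h2)
    rw [hγ] at h3
    exact hai b ⟨⟨y, hby⟩, hb0⟩ (-(b - a)) ⟨⟨x, h3⟩, fun z hz => by simpa using hs z hz⟩ (by abel)

/-- At an acute angle the Cartan numbers are positive integers with product at most 4 by
Cauchy–Schwarz. Neither is 1, so both are 2 and the gradients agree. -/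
theorem inner_nonpos_of_mem_simpleRoots (hΦ : IsLocalRootSystem P Φ L) (hP : IsConvex P)
    (hsolid : IsSolid P) (horb : ∀ z : E, (orbit (generatedGroup P Φ) z ∩ P).Subsingleton)
    {a b : E →ᵃ[ℝ] ℝ} (ha : a ∈ simpleRoots P Φ) (hb : b ∈ simpleRoots P Φ) (hab : a ≠ b) :
    (inner ℝ (grad a) (grad b) : ℝ) ≤ 0 := by
  by_contra! hC
  have h1 := hΦ.inner_coroot_ne_one hP hsolid horb ha hb
  have h2 := hΦ.inner_coroot_ne_one hP hsolid horb hb ha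
  obtain ⟨⟨⟨x, hax⟩, ha0⟩, -⟩ := ha
  obtain ⟨⟨⟨y, hby⟩, hb0⟩, -⟩ := hb
  have hA : 0 < ‖grad a‖ := norm_pos_iff.mpr (hΦ.grad_ne hax)
  have hB : 0 < ‖grad b‖ := norm_pos_iff.mpr (hΦ.grad_ne hby)
  obtain ⟨n, hn⟩ := (hΦ.weight_of_mem hax).2 _ (hΦ.weight_of_mem hby).1
  obtain ⟨m, hm⟩ := (hΦ.weight_of_mem hby).2 _ (hΦ.weight_of_mem hax).1
  rw [hn] at h1
  rw [hm] at h2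
  rw [inner_coroot, real_inner_comm] at hn
  rw [inner_coroot] at hm
  have hCle := real_inner_le_norm (grad a) (grad b)
  set C : ℝ := inner ℝ (grad a) (grad b) with hCdef
  have hn' : 2 * C = n * ‖grad a‖ ^ 2 := by rw [← hn]; field_simp
  have hm' : 2 * C = m * ‖grad b‖ ^ 2 := by rw [← hm]; field_simp
  have hn0 : 0 < n := by
    have : (0 : ℝ) < n := by rw [← hn]; positivity
    exact_mod_cast this
  have hm0 : 0 < m := by
    have : (0 : ℝ) < m := by rw [← hm]; positivity
    exact_mod_cast this
  have hnm : n * m ≤ 4 := by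
    have h3 : (n * m : ℝ) * (‖grad a‖ ^ 2 * ‖grad b‖ ^ 2) = 4 * (C * C) := by
      linear_combination (-m * ‖grad b‖ ^ 2) * hn' - (2 * C) * hm'
    have h4 : C * C ≤ ‖grad a‖ ^ 2 * ‖grad b‖ ^ 2 := by
      have := mul_le_mul hCle hCle hC.le (by positivity)
      linarith
    have h5 : 0 < ‖grad a‖ ^ 2 * ‖grad b‖ ^ 2 := by positivity
    have h6 : (n * m : ℝ) ≤ 4 := by
      by_contra! h7
      have := mul_lt_mul_of_pos_right h7 h5
      linarith
    exact_mod_cast h6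
  have hn1 : n ≠ 1 := fun h => h1 (by rw [h, Int.cast_one])
  have hm1 : m ≠ 1 := fun h => h2 (by rw [h, Int.cast_one])
  have hn2 : n = 2 := le_antisymm (by nlinarith [show 2 ≤ m by omega]) (by omega)
  have hm2 : m = 2 := le_antisymm (by nlinarith [show 2 ≤ n by omega]) (by omega)
  rw [hn2, Int.cast_ofNat] at hn'
  rw [hm2, Int.cast_ofNat] at hm'
  have hgrad : grad a = grad b := by
    rw [← sub_eq_zero, ← norm_eq_zero, ← sq_eq_zero_iff, norm_sub_sq_real]
    linarith
  have hshift : a x - b x = a y - b y := by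
    have e1 := apply_vadd a (y : E) ((x : E) -ᵥ (y : E))
    have e2 := apply_vadd b (y : E) ((x : E) -ᵥ (y : E))
    rw [vsub_vadd] at e1 e2
    rw [hgrad] at e1
    linarith
  rw [hΦ.apply_eq_zero hax, hΦ.apply_eq_zero hby] at hshift
  -- The constant difference gives `-(b x) = a y`, and both `b x` and `a y` are non-negative.
  have hbx : b x = 0 := by linarith [hb0 x x.2, ha0 y y.2]
  exact hab (eq_of_grad_eq hgrad ((hΦ.apply_eq_zero hax).trans hbx.symm))

theorem isObtuseSystem (hΦ : IsLocalRootSystem P Φ L) (hP : IsConvex P) (hsolid : IsSolid P)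
    (horb : ∀ z : E, (orbit (generatedGroup P Φ) z ∩ P).Subsingleton) {p : E}
    (hp : p ∈ interior P) : IsObtuseSystem (simpleRoots P Φ) p where
  pos := fun a ha => hΦ.pos_of_mem_positiveRoots ha.1 hp
  grad_ne := fun a ha => by
    obtain ⟨x, hx⟩ := ha.1.1
    exact hΦ.grad_ne hx
  integral := fun a ha b hb => by
    obtain ⟨x, hx⟩ := ha.1.1
    obtain ⟨y, hy⟩ := hb.1.1
    exact (hΦ.weight_of_mem hy).2 _ (hΦ.weight_of_mem hx).1
  obtuse := fun a ha b hb hab => hΦ.inner_nonpos_of_mem_simpleRoots hP hsolid horb ha hb hab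

/-- If a positive root in `Φ x` is a sum of two positive roots, both summands vanish at `x`, hence
lie in the finite set `Φ x`, and are smaller at `p`. -/
theorem mem_closure_simpleRoots (hΦ : IsLocalRootSystem P Φ L) (hP : IsConvex P) {p : E}
    (hp : p ∈ interior P) {α : E →ᵃ[ℝ] ℝ} (hα : α ∈ positiveRoots P Φ) :
    α ∈ AddSubmonoid.closure (simpleRoots P Φ) := by
  obtain ⟨x, hx⟩ := hα.1
  refine finite_value_induction (hΦ.finite x) p (Q := fun α => α ∈ positiveRoots P Φ →
    α ∈ AddSubmonoid.closure (simpleRoots P Φ)) (fun a hax ih ha => ?_) α hx hα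
  by_cases hs : a ∈ simpleRoots P Φ
  · exact AddSubmonoid.subset_closure hs
  have h : ∃ β ∈ positiveRoots P Φ, ∃ γ ∈ positiveRoots P Φ, a = β + γ := by
    by_contra! hcon
    exact hs ⟨ha, hcon⟩
  obtain ⟨β, hβ, γ, hγ, rfl⟩ := h
  have h0 : β x + γ x = 0 := by simpa using hΦ.apply_eq_zero hax
  have hβ0 := hβ.2 x x.2
  have hγ0 := hγ.2 x x.2
  obtain ⟨y, hy⟩ := hβ.1
  obtain ⟨z, hz⟩ := hγ.1
  have hβp := hΦ.pos_of_mem_positiveRoots hβ hp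
  have hγp := hΦ.pos_of_mem_positiveRoots hγ hp
  exact add_mem
    (ih β (hΦ.mem_of_apply_eq_zero hP hy (by linarith)) (by simpa using hγp) hβ)
    (ih γ (hΦ.mem_of_apply_eq_zero hP hz (by linarith)) (by simpa using hβp) hγ)

/-- The local systems are cut out of the system generated by the simple roots. -/
theorem eq_rootsAt_generatedRoots (hΦ : IsLocalRootSystem P Φ L) (hP : IsConvex P)
    (hsolid : IsSolid P) (horb : ∀ z : E, (orbit (generatedGroup P Φ) z ∩ P).Subsingleton)
    {p : E} (hp : p ∈ interior P) (x : P) :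
    Φ x = rootsAt (generatedRoots (simpleRoots P Φ)) x := by
  have hS := hΦ.isObtuseSystem hP hsolid horb hp
  have hrs := (hΦ.integral x).rootSystem
  have hx : ∀ a ∈ simpleRoots P Φ, 0 ≤ a x := fun a ha => ha.1.2 x x.2
  have hSx : ∀ a ∈ simpleRoots P Φ, a x = 0 → a ∈ Φ x := fun a ha h0 => by
    obtain ⟨y, hy⟩ := ha.1.1
    exact hΦ.mem_of_apply_eq_zero hP hy h0
  have hΦr : ∀ a ∈ simpleRoots P Φ, a x = 0 → ∀ f ∈ Φ x, reflEquiv a f ∈ Φ x :=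
    fun a ha h0 f hf => hrs.reflEquiv_mem (hSx a ha h0) hf
  have hΨr : ∀ a ∈ simpleRoots P Φ, a x = 0 →
      ∀ f ∈ rootsAt (generatedRoots (simpleRoots P Φ)) x,
        reflEquiv a f ∈ rootsAt (generatedRoots (simpleRoots P Φ)) x := by
    intro a ha h0 f hf
    refine ⟨map_mem_generatedRoots (reflEquiv_mem_reflGroup ha) hf.1, ?_⟩
    rw [reflEquiv_apply]
    simp [h0, hf.2]
  have hΦs : ∀ f ∈ Φ x, (f ∈ AddSubmonoid.closure (simpleRoots P Φ) ∧ 0 < f p) ∨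
      (-f ∈ AddSubmonoid.closure (simpleRoots P Φ) ∧ f p < 0) := by
    intro f hf
    rcases hΦ.mem_positiveRoots_or_neg_mem hf with h | h
    · exact Or.inl ⟨hΦ.mem_closure_simpleRoots hP hp h, hΦ.pos_of_mem_positiveRoots h hp⟩
    · refine Or.inr ⟨hΦ.mem_closure_simpleRoots hP hp h, ?_⟩
      simpa using hΦ.pos_of_mem_positiveRoots h hp
  have hΨs : ∀ f ∈ rootsAt (generatedRoots (simpleRoots P Φ)) x,
      (f ∈ AddSubmonoid.closure (simpleRoots P Φ) ∧ 0 < f p) ∨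
      (-f ∈ AddSubmonoid.closure (simpleRoots P Φ) ∧ f p < 0) :=
    fun f hf => hS.pos_or_pos_neg_of_mem_generatedRoots hf.1 hS.pos
  have hΨfin : (rootsAt (generatedRoots (simpleRoots P Φ)) x).Finite := by
    refine finite_of_finite_grad (fun f hf => hf.2) (finite_grad_image hΦ.lattice fun f hf =>
      weight_of_mem_generatedRoots (fun a ha => ?_) hf.1)
    obtain ⟨y, hy⟩ := ha.1.1
    exact hΦ.weight_of_mem hy
  -- The descent is run in both directions; reducedness of the source system settles the multiples
  -- of simple roots at its end.
  have hΦΨ := hS.mem_of_reflEquiv_stable hx (hΦ.finite x) (fun f hf => hΦ.apply_eq_zero hf)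
    (fun f hf => hΦ.grad_ne hf) hΦs hΦr hΨr (by
      intro a ha h0 c hc hca
      have h1 : c • a ∈ {β | ∃ c : ℝ, β = c • a} ∩ Φ x := ⟨⟨c, rfl⟩, hca⟩
      rw [hrs.reduced a (hSx a ha h0)] at h1
      rcases h1 with h1 | h1
      · rw [h1]
        exact ⟨subset_generatedRoots _ ha, h0⟩
      · have h2 := congrArg (fun f : E →ᵃ[ℝ] ℝ => f p) h1
        have h3 := hS.pos a ha
        have h4 := mul_pos hc h3
        have h5 : c * a p = -a p := by simpa using h2
        linarith)
  have hΨΦ := hS.mem_of_reflEquiv_stable hx hΨfin (fun f hf => hf.2)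
    (fun f hf => hS.grad_ne_of_mem_generatedRoots hf.1) hΨs hΨr hΦr (by
      intro a ha h0 c hc hca
      rw [hS.eq_one_of_smul_mem ha hc hca.1, one_smul]
      exact hSx a ha h0)
  ext f
  constructor
  · intro hf
    rcases hΦs f hf with h | h
    · exact hΦΨ f hf h.2
    · have h1 := hΦΨ (-f) (hrs.neg_mem hf) (by simpa using h.2)
      rw [← neg_neg f]
      exact ⟨hS.neg_mem_generatedRoots h1.1, by simpa using h1.2⟩
  · intro hf
    rcases hΨs f hf with h | h
    · exact hΨΦ f hf h.2
    · have h1 := hΨΦ (-f) ⟨hS.neg_mem_generatedRoots hf.1, by simpa using hf.2⟩ (by simpa using h.2)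
      rw [← neg_neg f]
      exact hrs.neg_mem h1

end IsLocalRootSystem

end LocalRoot

theorem mainTheorem4 {V E : Type*} [NormedAddCommGroup V] [InnerProductSpace ℝ V]
    [FiniteDimensional ℝ V] [MetricSpace E] [NormedAddTorsor V E]
    (P : Set E) (Φ : P → Set (E →ᵃ[ℝ] ℝ)) (L : AddSubgroup V)
    (hΦ : LocalRoot.IsLocalRootSystem P Φ L)
    (hconv : LocalRoot.IsConvex P) (hsolid : LocalRoot.IsSolid P)
    (horb : ∀ z : E, (LocalRoot.orbit (LocalRoot.generatedGroup P Φ) z ∩ P).Subsingleton) :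
    LocalRoot.IsTrivial P Φ L := by
  obtain ⟨p, hp⟩ : (interior P).Nonempty := by
    obtain ⟨x, hx⟩ := hsolid.1
    exact closure_nonempty_iff.mp ⟨x, hsolid.2 hx⟩
  have hS := hΦ.isObtuseSystem hconv hsolid horb hp
  have hcompl : interior P ⊆
      (⋃ α ∈ LocalRoot.generatedRoots (LocalRoot.simpleRoots P Φ), LocalRoot.hyperplane α)ᶜ := by
    intro z hz hmem
    obtain ⟨α, hα, h0⟩ := Set.mem_iUnion₂.mp hmem
    have h1 : α z = 0 := h0
    rcases hS.pos_or_pos_neg_of_mem_generatedRoots hα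
      (fun a ha => hΦ.pos_of_mem_positiveRoots ha.1 hz) with h | h <;> linarith [h.2]
  refine ⟨LocalRoot.generatedRoots (LocalRoot.simpleRoots P Φ),
    hS.isIntegralAffineRootSystem hΦ.lattice fun a ha => ?_, ⟨_, ⟨p, hcompl hp, rfl⟩, ?_⟩,
    hΦ.eq_rootsAt_generatedRoots hconv hsolid horb hp⟩
  · obtain ⟨x, hx⟩ := ha.1.1
    exact hΦ.weight_of_mem hx
  -- The connected interior lies in a single chamber, and `P` lies in the closure of its interior.
  · exact hsolid.2.trans (closure_mono
      (hconv.isPreconnected_interior.subset_connectedComponentIn hp hcompl))
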